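/- Let $M$ be an oriented smooth (Hausdorff, $\sigma$-compact) manifold of dimension $n\ge 1$ without boundary, with tangent bundle $\pi:TM\to M$. Let $U\subset TM\setminus\{0\}$ be a conic sub-bundle of full dimension $2n$: $\pi(U)=M$; $\lambda u\in U$ for all $u\in U$ and $\lambda\neq 0$; and $U$ is open in $TM$ or, more generally, a domain with smooth boundary transverse to the fibres (near each of its points $U=\{f\ge 0\}$ with $f$ smooth and with non-zero derivative along the fibre wherever $f=0$). Let $\mathcal R=\dot x^\mu\partial/\partial\dot x^\mu$ be the radial vector field. A *Vlasov field* on $U$ is a smooth vector field $W$ on $U$ with $\pi_*(W|_u)=u$ and $W\langle\dot h\rangle|_{\lambda u}=\lambda^2W\langle\dot h\rangle|_u$ for all $u\in U$, $\lambda>0$ and $h\in C^\infty(M)$, where $\dot h(u)=u\langle h\rangle$. A *Vlasov bivector* is a bivector field $\Psi=\mathcal R\wedge W$ with $W$ a Vlasov field. A smooth $(2n-2)$-form $\theta$ on $U$ satisfies the *transport equations* for $\Psi$ if $d\theta=0$ and $i_X\theta=i_Y\theta=0$ whenever $\Psi=X\wedge Y$ with $X,Y$ smooth vector fields on $U$.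 A *support form* is a smooth $1$-form $\chi$ on $U$ such that for every $u\in U$ the pullback of $\chi$ along the ray $(0,\infty)\to U$, $\lambda\mapsto\lambda u$, has compact support and integral $1$. For a $(2n-1)$-form $\alpha$ on $U$, a smooth $(n-1)$-form $J$ on $M$ is the *integral of $\alpha$ along the fibres*, $J=\pi_\varsigma\alpha$, if for every compactly supported smooth $1$-form $\beta$ on $M$ the integral $\int_U\pi^*\beta\wedge\alpha$ converges absolutely and $$\int_U\pi^*\beta\wedge\alpha=\int_M\beta\wedge J ,$$ where $TM$ carries the orientation of $dx^1\wedge\dots\wedge dx^n\wedge d\dot x^1\wedge\dots\wedge d\dot x^n$. We say that $\alpha$ has *vertically compact support* if for every compact $C\subset M$ there is a compact $K\subset U$ such that $\alpha$ vanishes at all points of $\pi^{-1}(C)\cap U$ outside $K$. **Lemma.** Let $\Psi$ be a Vlasov bivector on $U$ and let $\theta$ satisfy the transport equations for $\Psi$. Then the current $\mathcal J=\pi_\varsigma(\chi\wedge\theta)$ does not depend on the choice of the support form $\chi$. That is, let $\chi,\chi'$ be support forms on $U$. If $J=\pi_\varsigma(\chi\wedge\theta)$ and $J'=\pi_\varsigma(\chi'\wedge\theta)$,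 then $J=J'$. Moreover, if $\chi\wedge\theta$ and $\chi'\wedge\theta$ have vertically compact support, then a smooth $(n-1)$-form $J$ on $M$ satisfies $J=\pi_\varsigma(\chi\wedge\theta)$ if and only if it satisfies $J=\pi_\varsigma(\chi'\wedge\theta)$. -/

import Mathlib

open Set MeasureTheory
open scoped Manifold ContDiff Topology

noncomputable section

namespace VlasovCurrent

/-! ### Differential forms on manifolds -/

section Forms

variable {V : Type*} [AddCommGroup V] [Module ℝ V] [TopologicalSpace V]

/-- The wedge product `α ∧ η` of a `1`-form and a `k`-form on a vector space:
`(α ∧ η)(v₀, …, v_k) = ∑ i, (-1)^i α(v_i) η(v₀, …, v_{i-1}, v_{i+1}, …, v_k)`. -/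
def wedgeOne {k : ℕ} (α : V [⋀^Fin 1]→L[ℝ] ℝ) (η : V [⋀^Fin k]→L[ℝ] ℝ) :
    V [⋀^Fin (k + 1)]→L[ℝ] ℝ where
  toAlternatingMap := AlternatingMap.alternatizeUncurryFin
    (((ContinuousAlternatingMap.ofSubsingleton ℝ V ℝ (0 : Fin 1)).symm α).toLinearMap.smulRight
      η.toAlternatingMap)
  cont := by
    have h : Continuous fun v : Fin (k + 1) → V =>
        ∑ i : Fin (k + 1), (-1 : ℤ) ^ (i : ℕ) • (α (fun _ => v i) * η (i.removeNth v)) := by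
      refine continuous_finsetSum _ fun i _ => (continuous_zsmul _).comp ?_
      refine Continuous.mul (α.cont.comp (by fun_prop)) (η.cont.comp ?_)
      exact continuous_pi fun j => continuous_apply _
    convert h using 2 with v
    simp [AlternatingMap.alternatizeUncurryFin_apply]

/-- `i_X η = 0` for a `k`-form `η` on a vector space (for `k = 0` this always holds). -/
def InteriorZero {k : ℕ} (X : V) (η : V [⋀^Fin k]→L[ℝ] ℝ) : Prop :=
  ∀ v : Fin k → V, (∃ i, v i = X) → η v = 0

variable {E : Type*} [NormedAddCommGroup E] [NormedSpace ℝ E] {H : Type*} [TopologicalSpace H]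

/-- Differential `k`-forms (not necessarily smooth) on a manifold `N` modelled on `I`. -/
abbrev DForm (I : ModelWithCorners ℝ E H) (N : Type*) [TopologicalSpace N] [ChartedSpace H N]
    (k : ℕ) : Type _ :=
  ∀ x : N, TangentSpace I x [⋀^Fin k]→L[ℝ] ℝ

variable {I : ModelWithCorners ℝ E H} {N : Type*} [TopologicalSpace N] [ChartedSpace H N] {k : ℕ}

/-- The coordinate expression of a form in the preferred chart at `c`, that is, its pullback along
the inverse of the chart (meaningful on the target of the chart). -/
def DForm.inChart (η : DForm I N k) (c : N) (y : E) : E [⋀^Fin k]→L[ℝ] ℝ :=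
  (η ((extChartAt I c).symm y)).compContinuousLinearMap
    (mfderiv 𝓘(ℝ, E) I (extChartAt I c).symm y)

variable (I) in
/-- The coordinate image, in the preferred chart at `c`, of a subset `U` of the manifold. -/
def chartImage (c : N) (U : Set N) : Set E :=
  (extChartAt I c).target ∩ (extChartAt I c).symm ⁻¹' U

/-- `η` is a smooth form on `U` (up to the boundary, when `U` is a domain with boundary). -/
def DForm.SmoothOn (η : DForm I N k) (U : Set N) : Prop :=
  ∀ c : N, ContDiffOn ℝ ∞ (η.inChart c) (chartImage I c U)

/-- `dη = 0` on `U`. -/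
def DForm.ClosedOn (η : DForm I N k) (U : Set N) : Prop :=
  ∀ c : N, ∀ y ∈ chartImage I c U, extDerivWithin (η.inChart c) (chartImage I c U) y = 0

/-- The pointwise wedge product of a `1`-form field and a `k`-form field. -/
def DForm.wedge (α : DForm I N 1) (η : DForm I N k) : DForm I N (k + 1) :=
  fun x => wedgeOne (α x) (η x)

/-- `X` is a smooth vector field on `U`. -/
def SmoothVectorField (X : ∀ x : N, TangentSpace I x) [IsManifold I 1 N] (U : Set N) : Prop :=
  ContMDiffOn I I.tangent ∞ (fun x => (⟨x, X x⟩ : TangentBundle I N)) U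

/-- The simple bivector `X ∧ Y` at a point. -/
def bivector {x : N} (X Y : TangentSpace I x) : ⋀[ℝ]^2 (TangentSpace I x) :=
  exteriorPower.ιMulti ℝ 2 ![X, Y]

/-- The null condition `Null(Φ, η)` on `U` for a bivector field `Φ` and a form `η`:
`i_X η = i_Y η = 0` on `U` whenever `Φ = X ∧ Y` on `U` with `X`, `Y` smooth vector fields. -/
def NullCondition [IsManifold I 1 N] (U : Set N) (Φ : ∀ x : N, ⋀[ℝ]^2 (TangentSpace I x))
    (η : DForm I N k) : Prop :=
  ∀ X Y : ∀ x : N, TangentSpace I x, SmoothVectorField X U → SmoothVectorField Y U →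
    (∀ x ∈ U, Φ x = bivector (X x) (Y x)) →
    ∀ x ∈ U, InteriorZero (X x) (η x) ∧ InteriorZero (Y x) (η x)

end Forms

/-! ### Geometry of the tangent bundle

The base manifold `M` has dimension `n = d + 1`. -/

/-- The model space `ℝⁿ`, `n = d + 1`. -/
abbrev Model (d : ℕ) : Type := EuclideanSpace ℝ (Fin (d + 1))

section Tangent

variable {d : ℕ} {M : Type*} [TopologicalSpace M] [ChartedSpace (Model d) M]
  [IsManifold (𝓡 (d + 1)) ∞ M]

variable (d M) in
/-- The tangent bundle `TM`. -/
abbrev TM : Type _ := TangentBundle (𝓡 (d + 1)) M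

instance instIsManifoldTM : IsManifold (𝓡 (d + 1)).tangent ∞ (TM d M) := by
  have : IsManifold (𝓡 (d + 1)) (∞ + 1) M := by simpa using ‹IsManifold (𝓡 (d + 1)) ∞ M›
  infer_instance

instance instIsManifoldOneTM : IsManifold (𝓡 (d + 1)).tangent 1 (TM d M) :=
  IsManifold.of_le (n := ∞) (by simp)

/-- The vertical lift to `u` of a vector `v` tangent to `M` at the base point of `u`: the velocity
at `t = 0` of the curve `t ↦ u + t v` in the fibre. -/
def verticalLift (u : TM d M) (v : TangentSpace (𝓡 (d + 1)) u.proj) :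
    TangentSpace (𝓡 (d + 1)).tangent u :=
  mfderiv 𝓘(ℝ, Model d) (𝓡 (d + 1)).tangent
    (fun w : Model d => (⟨u.proj, w⟩ : TM d M)) (u.snd : Model d) v

/-- The radial vector field `R = ẋ^μ ∂/∂ẋ^μ`. -/
def radial (u : TM d M) : TangentSpace (𝓡 (d + 1)).tangent u :=
  verticalLift u u.snd

/-- Scalar multiplication in the fibres of `TM`. -/
def scale (c : ℝ) (u : TM d M) : TM d M := ⟨u.proj, c • u.snd⟩

/-- The scalar lift `ḣ(u) = u⟨h⟩` of a function `h` on `M`. -/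
def scalarLift (h : M → ℝ) (u : TM d M) : ℝ :=
  mfderiv (𝓡 (d + 1)) 𝓘(ℝ, ℝ) h u.proj u.snd

/-- The action `X⟨F⟩` at `u` of a tangent vector `X` of `TM` on a function `F` on `TM`. -/
def vectorAct {u : TM d M} (X : TangentSpace (𝓡 (d + 1)).tangent u) (F : TM d M → ℝ) : ℝ :=
  mfderiv (𝓡 (d + 1)).tangent 𝓘(ℝ, ℝ) F u X

/-- A conic sub-bundle of the slit tangent bundle, of full dimension, possibly with boundary. -/
structure IsConicSubbundle (U : Set (TM d M)) : Prop where
  slit : ∀ u ∈ U, u.snd ≠ 0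
  surjective : ∀ p : M, ∃ u ∈ U, u.proj = p
  conic : ∀ u ∈ U, ∀ c : ℝ, c ≠ 0 → scale c u ∈ U
  /-- Near each of its points `U` is given by `f ≥ 0`, where `f` is smooth and has non-zero
  derivative along the fibre wherever it vanishes (`f = 1` if `U` is open). -/
  smooth : ∀ u ∈ U, ∃ V : Set (TM d M), IsOpen V ∧ u ∈ V ∧ ∃ f : TM d M → ℝ,
    ContMDiffOn (𝓡 (d + 1)).tangent 𝓘(ℝ, ℝ) ∞ f V ∧ U ∩ V = {w ∈ V | 0 ≤ f w} ∧
    ∀ w ∈ V, f w = 0 → ∃ v : TangentSpace (𝓡 (d + 1)) w.proj, vectorAct (verticalLift w v) f ≠ 0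

/-- A Vlasov field on `U`: a smooth vector field that is horizontal and radially quadratic. -/
structure IsVlasovField (U : Set (TM d M))
    (W : ∀ u : TM d M, TangentSpace (𝓡 (d + 1)).tangent u) : Prop where
  smooth : SmoothVectorField W U
  horizontal : ∀ u ∈ U,
    mfderiv (𝓡 (d + 1)).tangent (𝓡 (d + 1)) (fun w : TM d M => w.proj) u (W u) = u.snd
  quadratic : ∀ h : M → ℝ, ContMDiff (𝓡 (d + 1)) 𝓘(ℝ, ℝ) ∞ h → ∀ u ∈ U, ∀ c : ℝ, 0 < c →
    vectorAct (W (scale c u)) (scalarLift h) = c ^ 2 * vectorAct (W u) (scalarLift h)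

/-- A Vlasov bivector on `U`: a bivector field of the form `R ∧ W` with `W` a Vlasov field.
(Such a bivector field is simple, radial and horizontal.) -/
def IsVlasovBivector (U : Set (TM d M))
    (Ψ : ∀ u : TM d M, ⋀[ℝ]^2 (TangentSpace (𝓡 (d + 1)).tangent u)) : Prop :=
  ∃ W : ∀ u : TM d M, TangentSpace (𝓡 (d + 1)).tangent u,
    IsVlasovField U W ∧ ∀ u ∈ U, Ψ u = bivector (radial u) (W u)

/-- The transport equations on `U` for a `(2n-2)`-form `θ` (note `2n - 2 = 2d`). -/
structure TransportEquations (U : Set (TM d M))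
    (Ψ : ∀ u : TM d M, ⋀[ℝ]^2 (TangentSpace (𝓡 (d + 1)).tangent u))
    (θ : DForm (𝓡 (d + 1)).tangent (TM d M) (2 * d)) : Prop where
  null : NullCondition U Ψ θ
  closed : θ.ClosedOn U

/-- The coefficient, with respect to `dc`, of the pullback of `χ` along the ray
`(0, ∞) → U`, `c ↦ c u`. -/
def rayCoeff (χ : DForm (𝓡 (d + 1)).tangent (TM d M) 1) (u : TM d M) (c : ℝ) : ℝ :=
  χ (scale c u) fun _ => verticalLift (scale c u) u.snd

/-- A support form: a smooth `1`-form on `U` whose pullback to every ray has compact support and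
integral one. -/
structure IsSupportForm (U : Set (TM d M)) (χ : DForm (𝓡 (d + 1)).tangent (TM d M) 1) :
    Prop where
  smooth : χ.SmoothOn U
  compactSupport : ∀ u ∈ U, HasCompactSupport fun c : Ioi (0 : ℝ) => rayCoeff χ u c
  integral_eq_one : ∀ u ∈ U, ∫ c in Ioi (0 : ℝ), rayCoeff χ u c = 1

/-- The pullback `π^* β` of a form along `π : TM → M`. -/
def pullbackProj {k : ℕ} (β : DForm (𝓡 (d + 1)) M k) : DForm (𝓡 (d + 1)).tangent (TM d M) k :=
  fun u => (β u.proj).compContinuousLinearMap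
    (mfderiv (𝓡 (d + 1)).tangent (𝓡 (d + 1)) (fun w : TM d M => w.proj) u)

/-- `α` has vertically compact support in `U`, locally uniformly in the base point: over a compact
subset of `M` the support of `α` lies in a compact subset of `U`. -/
def VerticalCompactSupport {k : ℕ} (U : Set (TM d M))
    (α : DForm (𝓡 (d + 1)).tangent (TM d M) k) : Prop :=
  ∀ C : Set M, IsCompact C → ∃ K : Set (TM d M), IsCompact K ∧ K ⊆ U ∧
    ∀ u ∈ U, u.proj ∈ C → α u ≠ 0 → u ∈ K

/-! ### Integration of top-degree forms and integration along the fibre -/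

/-- The standard frame of `ℝⁿ`. -/
def frame (d : ℕ) : Fin (d + 1) → Model d := fun i => EuclideanSpace.single i 1

/-- The frame `∂/∂x^1, …, ∂/∂x^n, ∂/∂ẋ^1, …, ∂/∂ẋ^n` of `ℝⁿ × ℝⁿ`. -/
def tangentFrame (d : ℕ) : Fin (2 * d + 1 + 1) → Model d × Model d := fun i =>
  Fin.append (fun j => (frame d j, (0 : Model d))) (fun j => ((0 : Model d), frame d j))
    (Fin.cast (by omega : 2 * d + 1 + 1 = (d + 1) + (d + 1)) i)

/-- An orientation of `M`, given by a nowhere vanishing smooth `n`-form. -/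
structure IsOrientationForm (o : DForm (𝓡 (d + 1)) M (d + 1)) : Prop where
  smooth : o.SmoothOn univ
  ne_zero : ∀ p : M, o p ≠ 0

variable [T2Space M] [SigmaCompactSpace M]

variable (d M) in
/-- A smooth partition of unity on `M` subordinate to the domains of the preferred charts. -/
theorem exists_chartPartition : ∃ ρ : SmoothPartitionOfUnity M (𝓡 (d + 1)) M univ,
    ρ.IsSubordinate fun c => (chartAt (Model d) c).source :=
  SmoothPartitionOfUnity.exists_isSubordinate (𝓡 (d + 1)) isClosed_univ _
    (fun c => (chartAt (Model d) c).open_source)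
    (fun x _ => mem_iUnion.2 ⟨x, mem_chart_source (Model d) x⟩)

variable (d M) in
/-- A chosen partition of unity subordinate to the charts. -/
def chartPartition : SmoothPartitionOfUnity M (𝓡 (d + 1)) M univ :=
  Classical.choose (exists_chartPartition d M)

/-- The contribution of the chart at `c` to the integrand of an `n`-form on `M` oriented by `o`;
the sign compares the orientation of the chart with that of `M`. -/
def baseIntegrand (o η : DForm (𝓡 (d + 1)) M (d + 1)) (c : M) (x : Model d) : ℝ :=
  chartPartition d M c ((extChartAt (𝓡 (d + 1)) c).symm x) *
    ((SignType.sign (o.inChart c x (frame d)) : ℝ) * η.inChart c x (frame d))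

/-- The integral `∫_M η` of a compactly supported smooth `n`-form on `M` oriented by `o`. -/
def integralM (o η : DForm (𝓡 (d + 1)) M (d + 1)) : ℝ :=
  ∑ᶠ c : M, ∫ x in (extChartAt (𝓡 (d + 1)) c).target, baseIntegrand o η c x

/-- The contribution of the chart of `TM` over the chart at `c` to the integrand of a `2n`-form on
`TM`. The orientation of `TM` is that of `dx^1 ∧ … ∧ dx^n ∧ dẋ^1 ∧ … ∧ dẋ^n`; it is the product of
the orientation of `M` and the induced orientation of the fibres, for either orientation of `M`. -/
def bundleIntegrand (Ω : DForm (𝓡 (d + 1)).tangent (TM d M) (2 * d + 1 + 1)) (c : M)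
    (y : Model d × Model d) : ℝ :=
  chartPartition d M c ((extChartAt (𝓡 (d + 1)).tangent (⟨c, 0⟩ : TM d M)).symm y).proj *
    Ω.inChart (⟨c, 0⟩ : TM d M) y (tangentFrame d)

/-- The `2n`-form `Ω` on `U` is (absolutely) integrable over each chart. -/
def IntegrableU (U : Set (TM d M)) (Ω : DForm (𝓡 (d + 1)).tangent (TM d M) (2 * d + 1 + 1)) :
    Prop :=
  ∀ c : M, IntegrableOn (bundleIntegrand Ω c)
    (chartImage (𝓡 (d + 1)).tangent (⟨c, 0⟩ : TM d M) U)

/-- The integral `∫_U Ω` of a `2n`-form over `U`. -/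
def integralU (U : Set (TM d M)) (Ω : DForm (𝓡 (d + 1)).tangent (TM d M) (2 * d + 1 + 1)) : ℝ :=
  ∑ᶠ c : M, ∫ y in chartImage (𝓡 (d + 1)).tangent (⟨c, 0⟩ : TM d M) U, bundleIntegrand Ω c y

/-- `J = π_ς α`: the smooth `(n-1)`-form `J` on `M` (oriented by `o`) is the integral along the
fibres of `π : U → M` of the `(2n-1)`-form `α` on `U`, i.e. for all compactly supported smooth
`1`-forms `β` on `M` the integral on the left converges and
`∫_U π^*β ∧ α = ∫_M β ∧ J`. -/
structure IsFibreIntegral (o : DForm (𝓡 (d + 1)) M (d + 1)) (U : Set (TM d M))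
    (α : DForm (𝓡 (d + 1)).tangent (TM d M) (2 * d + 1)) (J : DForm (𝓡 (d + 1)) M d) :
    Prop where
  smooth : J.SmoothOn univ
  integrable : ∀ β : DForm (𝓡 (d + 1)) M 1, β.SmoothOn univ →
    (∃ K : Set M, IsCompact K ∧ ∀ p ∉ K, β p = 0) →
    IntegrableU U ((pullbackProj β).wedge α)
  integral_eq : ∀ β : DForm (𝓡 (d + 1)) M 1, β.SmoothOn univ →
    (∃ K : Set M, IsCompact K ∧ ∀ p ∉ K, β p = 0) →
    integralU U ((pullbackProj β).wedge α) = integralM o (β.wedge J)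

end Tangent

end VlasovCurrent

end

/-! Let `R` be the radial field; in a chart `(x, v)` of `TM` it is the Euler field `(0, v)`. Since
`Ψ = R ∧ W`, the null condition gives `i_R θ = 0`. Together with `dθ = 0`, Cartan's formula gives
`L_R θ = 0`, so `θ` is invariant under the fibre scalings `v ↦ r v`, `r > 0`
(`compContinuousLinearMap_scaleSnd_eq`).

In `π^*β ∧ χ ∧ θ` both `π^*β` and `θ` are annihilated by `R`, so this top form sees `χ` only through
`χ(R)`: it equals `χ(R) π^*β ∧ τ ∧ θ` for any `τ` with `τ(R) = 1` (`wedgeOne_wedgeOne_eq_smul`).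
Take `τ = ⟨v, dv⟩` where `|v| = 1`. With the invariance of `θ`, the integrand at `(x, r v)` times
`r^(n-1)` becomes the ray coefficient of `χ` at `r` times a function of `(x, v)` that does not
involve `χ` (`wedge_inChart_scaleSnd`). In polar coordinates on the fibres the radial integral is
then `1` by the normalisation of `χ`, and what is left is an integral over the unit sphere bundle of
the chart, the same for all support forms (`setIntegral_eq_integral_sphere`, `integralU_wedge_eq`).
Absolute convergence is needed only for Fubini.

Hence `∫_M β ∧ (J - J') = 0` for all test forms `β`, and `J = J'` by the fundamental lemma of the
calculus of variations (`eq_zero_of_integralM_wedge_eq_zero`). For the equivalence only convergence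
for the other support form is missing; vertically compact support supplies it, since each chart
integrand is continuous and vanishes off a compact set (`VerticalCompactSupport.integrableU`). -/

namespace VlasovCurrent

/-! ### Wedge products with 1-forms and forms of top degree -/

section LinearAlgebra

variable {V : Type*} [AddCommGroup V] [Module ℝ V] [TopologicalSpace V]

theorem wedgeOne_apply {k : ℕ} (α : V [⋀^Fin 1]→L[ℝ] ℝ) (η : V [⋀^Fin k]→L[ℝ] ℝ)
    (v : Fin (k + 1) → V) :
    wedgeOne α η v =
      ∑ i : Fin (k + 1), (-1 : ℝ) ^ (i : ℕ) * (α (fun _ => v i) * η (i.removeNth v)) := by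
  change AlternatingMap.alternatizeUncurryFin _ v = _
  simp [AlternatingMap.alternatizeUncurryFin_apply]

theorem wedgeOne_compContinuousLinearMap {V' : Type*} [AddCommGroup V'] [Module ℝ V']
    [TopologicalSpace V'] {k : ℕ} (α : V [⋀^Fin 1]→L[ℝ] ℝ) (η : V [⋀^Fin k]→L[ℝ] ℝ)
    (L : V' →L[ℝ] V) :
    (wedgeOne α η).compContinuousLinearMap L =
      wedgeOne (α.compContinuousLinearMap L) (η.compContinuousLinearMap L) := by
  ext v
  simp only [ContinuousAlternatingMap.compContinuousLinearMap_apply, wedgeOne_apply]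
  rfl

/-- In each term of the expansion `X` is fed either to `α` or to `η`, and both annihilate it. -/
theorem InteriorZero.wedgeOne {k : ℕ} {X : V} {α : V [⋀^Fin 1]→L[ℝ] ℝ} {η : V [⋀^Fin k]→L[ℝ] ℝ}
    (hα : α (fun _ => X) = 0) (hη : InteriorZero X η) : InteriorZero X (wedgeOne α η) := by
  rintro v ⟨j, rfl⟩
  rw [wedgeOne_apply]
  refine Finset.sum_eq_zero fun i _ => ?_
  by_cases hij : j = i
  · subst hij; simp [hα]
  · obtain ⟨l, rfl⟩ := Fin.exists_succAbove_eq hij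
    rw [hη _ ⟨l, rfl⟩]; simp

/-- A form of top degree which is annihilated by a nonzero vector vanishes. -/
theorem InteriorZero.eq_zero_of_finrank [FiniteDimensional ℝ V] {m : ℕ}
    (hm : Module.finrank ℝ V = m) {X : V} (hX : X ≠ 0) {η : V [⋀^Fin m]→L[ℝ] ℝ}
    (h : InteriorZero X η) : η = 0 := by
  let b := Module.finBasisOfFinrankEq ℝ V hm
  obtain ⟨i, hi⟩ : ∃ i, b.repr X i ≠ 0 := by
    by_contra! h0
    exact hX (b.repr.map_eq_zero_iff.1 (Finsupp.ext h0))
  -- Putting `X` in place of a basis vector along which it has a nonzero coordinate multiplies the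
  -- value of `η` by that coordinate, yet gives zero.
  have key : η.toAlternatingMap (Function.update b i X) = b.repr X i * η.toAlternatingMap b := by
    conv_lhs => rw [← b.sum_repr X]
    rw [AlternatingMap.map_update_sum, Finset.sum_eq_single i]
    · rw [AlternatingMap.map_update_smul, Function.update_eq_self, smul_eq_mul]
    · intro j _ hj
      rw [AlternatingMap.map_update_smul, AlternatingMap.map_update_self _ _ hj.symm, smul_zero]
    · simp
  have h0 : η.toAlternatingMap (Function.update b i X) = 0 := h _ ⟨i, by simp⟩
  have hb : η.toAlternatingMap b = 0 := by
    rw [h0] at key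
    exact (mul_eq_zero.1 key.symm).resolve_left hi
  apply ContinuousAlternatingMap.toAlternatingMap_injective
  rw [AlternatingMap.eq_smul_basis_det b η.toAlternatingMap, hb]
  simp

theorem wedgeOne_sub_right {k : ℕ} (α : V [⋀^Fin 1]→L[ℝ] ℝ) (η η' : V [⋀^Fin k]→L[ℝ] ℝ)
    [IsTopologicalAddGroup V] :
    wedgeOne α (η - η') = wedgeOne α η - wedgeOne α η' := by
  ext v
  simp only [wedgeOne_apply, ContinuousAlternatingMap.sub_apply, ← Finset.sum_sub_distrib]
  exact Finset.sum_congr rfl fun i _ => by ring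

theorem wedgeOne_smul_right {k : ℕ} (α : V [⋀^Fin 1]→L[ℝ] ℝ) (c : ℝ) (η : V [⋀^Fin k]→L[ℝ] ℝ) :
    wedgeOne α (c • η) = c • wedgeOne α η := by
  ext v
  simp only [wedgeOne_apply, ContinuousAlternatingMap.smul_apply, smul_eq_mul, Finset.mul_sum]
  exact Finset.sum_congr rfl fun i _ => by ring

theorem wedgeOne_smul_left {k : ℕ} (α : V [⋀^Fin 1]→L[ℝ] ℝ) (c : ℝ) (η : V [⋀^Fin k]→L[ℝ] ℝ) :
    wedgeOne (c • α) η = c • wedgeOne α η := by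
  ext v
  simp only [wedgeOne_apply, ContinuousAlternatingMap.smul_apply, smul_eq_mul, Finset.mul_sum]
  exact Finset.sum_congr rfl fun i _ => by ring

theorem wedgeOne_sub_left {k : ℕ} (α α' : V [⋀^Fin 1]→L[ℝ] ℝ) (η : V [⋀^Fin k]→L[ℝ] ℝ)
    [IsTopologicalAddGroup V] :
    wedgeOne (α - α') η = wedgeOne α η - wedgeOne α' η := by
  ext v
  simp only [wedgeOne_apply, ContinuousAlternatingMap.sub_apply, ← Finset.sum_sub_distrib]
  exact Finset.sum_congr rfl fun i _ => by ring

/-- If `β(X) = 0`, `i_X θ = 0` and `τ(X) = 1`, then `β ∧ χ ∧ θ = χ(X) β ∧ τ ∧ θ` in top degree. -/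
theorem wedgeOne_wedgeOne_eq_smul [FiniteDimensional ℝ V] [IsTopologicalAddGroup V] {k : ℕ}
    (hk : Module.finrank ℝ V = k + 1 + 1) {X : V} {β χ τ : V [⋀^Fin 1]→L[ℝ] ℝ}
    {θ : V [⋀^Fin k]→L[ℝ] ℝ} (hβ : β (fun _ => X) = 0) (hθ : InteriorZero X θ)
    (hτ : τ (fun _ => X) = 1) :
    wedgeOne β (wedgeOne χ θ) = χ (fun _ => X) • wedgeOne β (wedgeOne τ θ) := by
  have hX : X ≠ 0 := by
    rintro rfl
    rw [τ.map_coord_zero 0 rfl] at hτ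
    exact zero_ne_one hτ
  -- `χ - χ(X) τ` annihilates `X`, so all three factors of this top form do.
  have h : InteriorZero X (wedgeOne β (wedgeOne (χ - χ (fun _ => X) • τ) θ)) :=
    InteriorZero.wedgeOne hβ (InteriorZero.wedgeOne (by simp [hτ]) hθ)
  have h0 := h.eq_zero_of_finrank hk hX
  rw [wedgeOne_sub_left, wedgeOne_smul_left, wedgeOne_sub_right, wedgeOne_smul_right] at h0
  exact sub_eq_zero.1 h0

end LinearAlgebra

/-! ### Cartan's formula and scale invariance -/

section Cartan

variable {E F : Type*} [NormedAddCommGroup E] [NormedSpace ℝ E] [NormedAddCommGroup F]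
  [NormedSpace ℝ F] {k : ℕ}

/-- Scaling of the second factor. -/
def scaleSnd (E F : Type*) [NormedAddCommGroup E] [NormedSpace ℝ E] [NormedAddCommGroup F]
    [NormedSpace ℝ F] (r : ℝ) : (E × F) →L[ℝ] (E × F) :=
  (ContinuousLinearMap.id ℝ E).prodMap (r • ContinuousLinearMap.id ℝ F)

@[simp]
theorem scaleSnd_apply (r : ℝ) (y : E × F) : scaleSnd E F r y = (y.1, r • y.2) := rfl

/-- The projection to the second factor, as an endomorphism of the product. -/
def euler (E F : Type*) [NormedAddCommGroup E] [NormedSpace ℝ E] [NormedAddCommGroup F]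
    [NormedSpace ℝ F] : (E × F) →L[ℝ] (E × F) :=
  (0 : E →L[ℝ] E).prodMap (ContinuousLinearMap.id ℝ F)

@[simp]
theorem euler_apply (y : E × F) : euler E F y = (0, y.2) := rfl

variable {S : Set (E × F)} {T : (E × F) → (E × F) [⋀^Fin k]→L[ℝ] ℝ}

/-- Cartan's formula: a closed form annihilated by the Euler field has vanishing Lie derivative. -/
theorem lieDerivative_euler_eq_zero (hS : UniqueDiffOn ℝ S) (hT : DifferentiableOn ℝ T S)
    (hd : ∀ y ∈ S, extDerivWithin T S y = 0) (hi : ∀ y ∈ S, InteriorZero (euler E F y) (T y))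
    {y : E × F} (hy : y ∈ S) (w : Fin k → E × F) :
    fderivWithin ℝ T S y (euler E F y) w
      + ∑ i, T y (Function.update w i (euler E F (w i))) = 0 := by
  have h := congrArg (fun η => η (Fin.cons (euler E F y) w)) (hd y hy)
  simp only [extDerivWithin, ContinuousAlternatingMap.alternatizeUncurryFin_apply,
    Fin.sum_univ_succ, Fin.cons_zero, Fin.cons_succ] at h
  -- In degree zero the sum is empty and `dT(E) = 0` is already the claim. Otherwise the remaining
  -- terms of `dT(E, w)` are found by differentiating `i_E T = 0`.
  cases k with
  | zero => simpa using h
  | succ k =>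
    -- Derivative in the direction `u` of the identity `T_z(E_z, w') = 0`; the Euler field is
    -- linear, so its derivative along `u` is `E_u`.
    have key : ∀ (u : E × F) (w' : Fin k → E × F),
        fderivWithin ℝ T S y u (Fin.cons (euler E F y) w')
          + T y (Fin.cons (euler E F u) w') = 0 := by
      intro u w'
      have hg : ∀ i : Fin (k + 1), DifferentiableWithinAt ℝ
          ((fun i z => (Fin.cons (euler E F z) w' : Fin (k + 1) → E × F) i) i) S y := by
        intro i
        refine Fin.cases ?_ (fun i => ?_) i
        · exact (euler E F).differentiableAt.differentiableWithinAt
        · exact differentiableWithinAt_const _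
      have h1 := fderivWithin_continuousAlternatingMap_apply_apply (hT y hy) hg (hS y hy) u
      have h0 : fderivWithin ℝ (fun z => T z
          fun i => (Fin.cons (euler E F z) w' : Fin (k + 1) → E × F) i) S y = 0 := by
        rw [fderivWithin_congr (f := fun _ => (0 : ℝ)) (fun z hz => hi z hz _ ⟨0, rfl⟩)
          (hi y hy _ ⟨0, rfl⟩)]
        simp
      rw [h0, Fin.sum_univ_succ] at h1
      have h2 : ∀ i : Fin k, fderivWithin ℝ
          (fun z => (Fin.cons (euler E F z) w' : Fin (k + 1) → E × F) i.succ) S y u = 0 := by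
        intro i
        simp
      have h3 : fderivWithin ℝ
          (fun z => (Fin.cons (euler E F z) w' : Fin (k + 1) → E × F) 0) S y u = euler E F u := by
        simp only [Fin.cons_zero]
        rw [(euler E F).fderivWithin (hS y hy)]
      rw [h3, Finset.sum_eq_zero (fun i _ => by
        rw [h2]; exact (T y).map_coord_zero i.succ (by simp)), add_zero] at h1
      simpa [Fin.update_cons_zero] using h1.symm
    -- The sign `(-1)^(i+1)` of the exterior derivative, the minus sign of `key` and the sign
    -- `(-1)^i` of moving the first argument to slot `i` cancel.
    have hsum : ∀ i : Fin (k + 1), (-1 : ℤ) ^ (i.succ : ℕ) •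
        fderivWithin ℝ T S y (w i) (i.succ.removeNth (Fin.cons (euler E F y) w : Fin (k + 2) → E × F)) =
        T y (Function.update w i (euler E F (w i))) := by
      intro i
      have e1 : i.succ.removeNth (Fin.cons (euler E F y) w : Fin (k + 2) → E × F) =
          (Fin.cons (euler E F y) (i.removeNth w) : Fin (k + 1) → E × F) := by
        ext j : 1
        refine Fin.cases ?_ (fun j => ?_) j
        · simp [Fin.removeNth]
        · simp [Fin.removeNth]
      rw [e1, eq_neg_of_add_eq_zero_left (key (w i) (i.removeNth w))]
      have e2 := (T y).toAlternatingMap.map_insertNth i (euler E F (w i)) (i.removeNth w)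
      rw [Fin.insertNth_removeNth] at e2
      have e3 : T y (Function.update w i (euler E F (w i))) =
        (-1 : ℤ) ^ (i : ℕ) • T y (Fin.cons (euler E F (w i)) (i.removeNth w)) := by
        refine e2.trans ?_
        rfl
      rw [e3, Fin.val_succ, pow_succ]
      simp
    have hz : (0 : Fin (k + 2)).removeNth (Fin.cons (euler E F y) w : Fin (k + 2) → E × F) = w := by
      ext j : 1
      simp [Fin.removeNth]
    rw [Finset.sum_congr rfl fun i _ => hsum i, hz] at h
    simpa using h

/-- The pullback of `T` by the scaling `s`, taken at `y`, has derivative `1/s` times the pulled-back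
Lie derivative along the Euler field. This vanishes, so the pullback is constant on `(0, ∞)`; at `s
= 1` it is `T y`. -/
theorem compContinuousLinearMap_scaleSnd_eq (hS : UniqueDiffOn ℝ S) (hT : DifferentiableOn ℝ T S)
    (hd : ∀ y ∈ S, extDerivWithin T S y = 0) (hi : ∀ y ∈ S, InteriorZero (euler E F y) (T y))
    (hc : ∀ y ∈ S, ∀ r : ℝ, 0 < r → scaleSnd E F r y ∈ S)
    {y : E × F} (hy : y ∈ S) {r : ℝ} (hr : 0 < r) :
    (T (scaleSnd E F r y)).compContinuousLinearMap (scaleSnd E F r) = T y := by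
  ext v
  let γ : ℝ → E × F := fun s => scaleSnd E F s y
  have hderiv : ∀ (z : E × F) (s : ℝ), HasDerivAt (fun s => scaleSnd E F s z) (euler E F z) s := by
    intro z s
    have := (hasDerivAt_const s z.1).prodMk ((hasDerivAt_id s).smul_const z.2)
    simpa using this
  have hφ : ∀ s ∈ Ioi (0 : ℝ), HasDerivAt (fun s => T (γ s) fun i => scaleSnd E F s (v i)) 0 s := by
    intro s hs
    have hs0 : (0 : ℝ) < s := hs
    have h1 : HasFDerivWithinAt (fun s => T (γ s))
        (fderivWithin ℝ T S (γ s) ∘L ContinuousLinearMap.toSpanSingleton ℝ (euler E F y))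
        (Ioi 0) s :=
      (hT _ (hc y hy s hs)).hasFDerivWithinAt.comp s (hderiv y s).hasFDerivAt.hasFDerivWithinAt
        (fun t ht => hc y hy t ht)
    have h2 := h1.continuousAlternatingMap_apply (g := fun i s => scaleSnd E F s (v i))
      (fun i => (hderiv (v i) s).hasFDerivAt.hasFDerivWithinAt)
    have h3 := (h2.hasFDerivAt (Ioi_mem_nhds hs)).hasDerivAt
    refine h3.congr_deriv ?_
    have h4 := lieDerivative_euler_eq_zero hS hT hd hi (hc y hy s hs)
      (fun i => scaleSnd E F s (v i))
    -- At the scaled point the Lie derivative identity is `s` times the derivative sought; dividing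
    -- by `s > 0` removes the factor.
    have e1 : ∀ z : E × F, euler E F (scaleSnd E F s z) = s • euler E F z := by
      intro z; simp
    simp only [e1, map_smul] at h4
    have e2 : ∀ i, T (γ s) (Function.update (fun i => scaleSnd E F s (v i)) i (s • euler E F (v i)))
        = s • T (γ s) (Function.update (fun i => scaleSnd E F s (v i)) i (euler E F (v i))) :=
      fun i => (T (γ s)).map_update_smul _ i s _
    have h5 : s • (fderivWithin ℝ T S (γ s) (euler E F y) (fun i => scaleSnd E F s (v i)) +
      ∑ i, T (γ s) (Function.update (fun i => scaleSnd E F s (v i)) i (euler E F (v i)))) = 0 := by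
      rw [smul_add, Finset.smul_sum, ← h4]
      congr 1
      exact Finset.sum_congr rfl fun i _ => (e2 i).symm
    have h6 := (smul_eq_zero.1 h5).resolve_left hs0.ne'
    simpa using h6
  have hconst := (convex_Ioi (0 : ℝ)).is_const_of_fderivWithin_eq_zero (𝕜 := ℝ)
    (f := fun s => T (γ s) fun i => scaleSnd E F s (v i))
    (fun s hs => (hφ s hs).differentiableAt.differentiableWithinAt)
    (fun s hs => by
      rw [fderivWithin_of_isOpen isOpen_Ioi hs, (hφ s hs).hasFDerivAt.fderiv]
      ext; simp) hr (mem_Ioi.2 (one_pos (α := ℝ)))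
  have hγ : γ 1 = y := by simp [γ]
  simp only [hγ] at hconst
  simpa [γ, Function.comp_def] using hconst

end Cartan

/-! ### Unique differentiability at boundary points -/

section UniqueDiff

/-- A domain given by `0 ≤ f`, with `f` regular where it vanishes, is a set of unique
differentiability. -/
theorem uniqueDiffWithinAt_of_nonneg {E : Type*} [NormedAddCommGroup E] [NormedSpace ℝ E]
    {S : Set E} {f : E → ℝ} {f' : E →L[ℝ] ℝ} {x : E} (hf : HasFDerivAt f f' x)
    (hS : ∀ᶠ y in 𝓝 x, 0 ≤ f y → y ∈ S) (hx : 0 ≤ f x) (h0 : f x = 0 → f' ≠ 0) :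
    UniqueDiffWithinAt ℝ S x := by
  rcases hx.eq_or_lt with hx | hx
  · obtain ⟨w, hw⟩ : ∃ w, 0 < f' w := by
      obtain ⟨w, hw⟩ := DFunLike.ne_iff.1 (h0 hx.symm)
      rcases lt_or_gt_of_ne hw with h | h
      · exact ⟨-w, by simpa using h⟩
      · exact ⟨w, h⟩
    -- Where `f x = 0`, every direction with `f' v > 0` points into `S`, as `f (x + t v) > 0` for
    -- small `t > 0`. This open half-space spans `E`.
    have hcone : ∀ v, 0 < f' v → v ∈ tangentConeAt ℝ S x := by
      intro v hv
      have hline : HasDerivAt (fun t : ℝ => x + t • v) v 0 := by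
        simpa using ((hasDerivAt_id (0 : ℝ)).smul_const v).const_add x
      have hft : HasDerivAt (fun t : ℝ => f (x + t • v)) (f' v) 0 := by
        have := HasFDerivAt.comp_hasDerivAt (0 : ℝ) (f := fun t : ℝ => x + t • v)
          (by simpa using hf) hline
        simpa [Function.comp_def] using this
      have hpos : ∀ᶠ t in 𝓝[>] (0 : ℝ), 0 < f (x + t • v) := by
        have hs := (hasDerivAt_iff_tendsto_slope.1 hft).mono_left
          (nhdsWithin_mono 0 (fun t ht => ne_of_gt ht : Ioi (0 : ℝ) ⊆ {0}ᶜ))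
        filter_upwards [hs.eventually (lt_mem_nhds hv), self_mem_nhdsWithin] with t ht ht0
        rw [slope_def_field] at ht
        simp only [zero_smul, add_zero, ← hx, sub_zero] at ht
        exact (div_pos_iff_of_pos_right (show (0 : ℝ) < t from ht0)).1 ht
      have hcont : Filter.Tendsto (fun t : ℝ => x + t • v) (𝓝[>] 0) (𝓝 x) := by
        have := hline.continuousAt.tendsto
        simp only [zero_smul, add_zero] at this
        exact this.mono_left nhdsWithin_le_nhds
      refine mem_tangentConeAt_of_add_smul_mem (l := 𝓝[>] (0 : ℝ)) (c := id)
        (nhdsWithin_mono 0 (fun t ht => ne_of_gt ht)) ?_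
      filter_upwards [hpos, hcont.eventually hS] with t h1 h2
      exact h2 h1.le
    refine ⟨?_, ?_⟩
    · have : (Submodule.span ℝ (tangentConeAt ℝ S x)) = ⊤ := by
        rw [eq_top_iff]
        intro v _
        obtain ⟨c, hc⟩ : ∃ c : ℝ, 0 < f' (v + c • w) := by
          -- This `c` makes `f' (v + c w) = 1`, so `v` is a difference of vectors of the span.
          refine ⟨(1 - f' v) / f' w, ?_⟩
          rw [map_add, map_smul, smul_eq_mul, div_mul_cancel₀ _ hw.ne']
          linarith
        have := Submodule.sub_mem _ (Submodule.subset_span (hcone _ hc))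
          (Submodule.smul_mem _ c (Submodule.subset_span (hcone w hw)))
        simpa using this
      rw [this]
      exact dense_univ
    · exact subset_closure (hS.self_of_nhds hx.le)
  · have : S ∈ 𝓝 x := by
      filter_upwards [hS, hf.continuousAt.eventually (lt_mem_nhds hx)] with y h1 h2
      exact h1 h2.le
    exact uniqueDiffWithinAt_of_mem_nhds this

end UniqueDiff

/-! ### Polar coordinates in the fibres -/

section Polar

variable {E : Type*} [NormedAddCommGroup E] [NormedSpace ℝ E] [FiniteDimensional ℝ E]
  [Nontrivial E] [MeasurableSpace E] [BorelSpace E]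

/-- Integration in polar coordinates. -/
theorem integral_eq_integral_toSphere (μ : Measure E) [μ.IsAddHaarMeasure] {f : E → ℝ}
    (hf : Integrable f μ) :
    ∫ x, f x ∂μ = ∫ w : Metric.sphere (0 : E) 1, (∫ r in Ioi (0 : ℝ),
      r ^ (Module.finrank ℝ E - 1) * f (r • (w : E))) ∂μ.toSphere := by
  set n := Module.finrank ℝ E - 1
  let g : Metric.sphere (0 : E) 1 × Ioi (0 : ℝ) → ℝ := fun p => f ((p.2 : ℝ) • (p.1 : E))
  have hg : ∀ x : ({0}ᶜ : Set E), g (homeomorphUnitSphereProd E x) = f x := by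
    intro x
    have hx : ‖(x : E)‖ ≠ 0 := norm_ne_zero_iff.2 x.2
    simp [g, homeomorphUnitSphereProd_apply_fst_coe, homeomorphUnitSphereProd_apply_snd_coe,
      smul_smul, mul_inv_cancel₀ hx]
  have hmp := μ.measurePreserving_homeomorphUnitSphereProd
  have hemb : MeasurableEmbedding (homeomorphUnitSphereProd E) :=
    (homeomorphUnitSphereProd E).measurableEmbedding
  have h1 : ∫ x, f x ∂μ = ∫ p, g p ∂(μ.toSphere.prod (.volumeIoiPow n)) := by
    rw [← hmp.integral_comp hemb]
    simp_rw [hg]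
    rw [integral_subtype_comap (measurableSet_singleton _).compl f,
      restrict_compl_singleton]
  have hint : Integrable g (μ.toSphere.prod (.volumeIoiPow n)) := by
    rw [← hmp.integrable_comp_emb hemb]
    have : g ∘ homeomorphUnitSphereProd E = f ∘ Subtype.val := funext hg
    rw [this, ← integrableOn_iff_comap_subtypeVal (measurableSet_singleton _).compl]
    exact hf.integrableOn
  rw [h1, integral_prod _ hint]
  refine integral_congr_ae (Filter.Eventually.of_forall fun w => ?_)
  simp only [Measure.volumeIoiPow, ENNReal.ofReal]
  rw [integral_withDensity_eq_integral_smul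
    (measurable_subtype_coe.pow_const _).real_toNNReal,
    integral_subtype_comap measurableSet_Ioi
      fun a : ℝ => Real.toNNReal (a ^ n) • f (a • (w : E)),
    setIntegral_congr_fun measurableSet_Ioi fun x hx => ?_]
  simp only [NNReal.smul_def, Real.coe_toNNReal _ (pow_nonneg (le_of_lt (mem_Ioi.1 hx)) _),
    smul_eq_mul]

/-- Fibrewise polar coordinates on a conic set: if `r ^ (n - 1) F(x, r w) = a(x, w, r) G(x, w)`
with `∫ a(x, w, r) dr = 1`, then the integral of `F` is that of `G` over the fibrewise sphere. -/
theorem setIntegral_eq_integral_sphere {X : Type*} [MeasurableSpace X] (ν : Measure X) [SFinite ν]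
    (μ : Measure E) [μ.IsAddHaarMeasure] {S : Set (X × E)} (hS : MeasurableSet S)
    (hc : ∀ x v, ∀ r : ℝ, 0 < r → ((x, r • v) ∈ S ↔ (x, v) ∈ S))
    {F G : X × E → ℝ} {a : X × E → ℝ → ℝ} (hF : IntegrableOn F S (ν.prod μ))
    (hFG : ∀ x v, (x, v) ∈ S → ‖v‖ = 1 → ∀ r : ℝ, 0 < r →
      r ^ (Module.finrank ℝ E - 1) * F (x, r • v) = a (x, v) r * G (x, v))
    (ha : ∀ x v, (x, v) ∈ S → ‖v‖ = 1 → ∫ r in Ioi (0 : ℝ), a (x, v) r = 1) :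
    ∫ y in S, F y ∂(ν.prod μ) =
      ∫ x, ∫ w : Metric.sphere (0 : E) 1, S.indicator G (x, (w : E)) ∂μ.toSphere ∂ν := by
  have hi : Integrable (S.indicator F) (ν.prod μ) := (integrable_indicator_iff hS).2 hF
  rw [← integral_indicator hS, integral_prod _ hi]
  refine integral_congr_ae ?_
  -- By Fubini almost every fibre slice is integrable, as polar coordinates require. The indicator
  -- of `S` is constant on open rays.
  filter_upwards [hi.prod_right_ae] with x hx
  rw [integral_eq_integral_toSphere μ hx]
  refine integral_congr_ae (Filter.Eventually.of_forall fun w => ?_)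
  have hw : ‖(w : E)‖ = 1 := by simp
  by_cases hwS : (x, (w : E)) ∈ S
  · have : ∀ r ∈ Ioi (0 : ℝ), r ^ (Module.finrank ℝ E - 1) * S.indicator F (x, r • (w : E)) =
        a (x, w) r * G (x, w) := by
      intro r hr
      rw [indicator_of_mem ((hc x w r hr).2 hwS), hFG x w hwS hw r hr]
    simp only
    rw [setIntegral_congr_fun measurableSet_Ioi this, integral_mul_const, ha x w hwS hw,
      indicator_of_mem hwS, one_mul]
  · have : ∀ r ∈ Ioi (0 : ℝ), r ^ (Module.finrank ℝ E - 1) * S.indicator F (x, r • (w : E)) = 0 := by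
      intro r hr
      rw [indicator_of_notMem (fun h => hwS ((hc x w r hr).1 h)), mul_zero]
    simp only
    rw [setIntegral_congr_fun measurableSet_Ioi this, indicator_of_notMem hwS, integral_zero]

end Polar

/-! ### Differentials of charts and their inverses -/

section Charts

variable {E : Type*} [NormedAddCommGroup E] [NormedSpace ℝ E] {H : Type*} [TopologicalSpace H]
  {I : ModelWithCorners ℝ E H} [I.Boundaryless] {N : Type*} [TopologicalSpace N]
  [ChartedSpace H N] [IsManifold I 1 N]

theorem mdifferentiableAt_extChartAt_symm {c : N} {y : E} (hy : y ∈ (extChartAt I c).target) :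
    MDifferentiableAt 𝓘(ℝ, E) I (extChartAt I c).symm y := by
  have := mdifferentiableWithinAt_extChartAt_symm (I := I) hy
  rwa [I.range_eq_univ, mdifferentiableWithinAt_univ] at this

theorem mfderiv_extChartAt_comp_mfderiv_symm {c : N} {y : E} (hy : y ∈ (extChartAt I c).target) :
    (mfderiv I 𝓘(ℝ, E) (extChartAt I c) ((extChartAt I c).symm y)) ∘L
      (mfderiv 𝓘(ℝ, E) I (extChartAt I c).symm y) = ContinuousLinearMap.id _ _ := by
  have := mfderiv_extChartAt_comp_mfderivWithin_extChartAt_symm (I := I) hy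
  rwa [I.range_eq_univ, mfderivWithin_univ] at this

theorem mfderiv_symm_comp_mfderiv_extChartAt {c : N} {y : E} (hy : y ∈ (extChartAt I c).target) :
    (mfderiv 𝓘(ℝ, E) I (extChartAt I c).symm y) ∘L
      (mfderiv I 𝓘(ℝ, E) (extChartAt I c) ((extChartAt I c).symm y)) =
      ContinuousLinearMap.id _ _ := by
  have := mfderivWithin_extChartAt_symm_comp_mfderiv_extChartAt (I := I) hy
  rwa [I.range_eq_univ, mfderivWithin_univ] at this

end Charts

/-! ### The radial field, the projection and forms in charts of the tangent bundle -/

section TangentCharts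

variable {d : ℕ} {M : Type*} [TopologicalSpace M] [ChartedSpace (Model d) M]
  [IsManifold (𝓡 (d + 1)) ∞ M]

theorem tangent_extChartAt_target (u₀ : TM d M) :
    (extChartAt (𝓡 (d + 1)).tangent u₀).target =
      (extChartAt (𝓡 (d + 1)) u₀.proj).target ×ˢ univ := by
  rw [FiberBundle.extChartAt_target]
  congr 1
  refine inter_eq_left.2 fun x hx => ?_
  have := (extChartAt (𝓡 (d + 1)) u₀.proj).map_target hx
  simpa using this

theorem mem_tangent_extChartAt_target {u₀ : TM d M} {y : Model d × Model d} :
    y ∈ (extChartAt (𝓡 (d + 1)).tangent u₀).target ↔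
      y.1 ∈ (extChartAt (𝓡 (d + 1)) u₀.proj).target := by
  rw [tangent_extChartAt_target]; simp

theorem mem_tangent_extChartAt_source {u₀ u : TM d M} :
    u ∈ (extChartAt (𝓡 (d + 1)).tangent u₀).source ↔
      u.proj ∈ (extChartAt (𝓡 (d + 1)) u₀.proj).source := by
  rw [extChartAt_source, extChartAt_source, TangentBundle.mem_chart_source_iff]

/-- The fibre coordinate of the chart of `TM` over the chart at `c`. -/
noncomputable abbrev fibreCoord (c p : M) : TangentSpace (𝓡 (d + 1)) p →L[ℝ] Model d :=
  (trivializationAt (Model d) (TangentSpace (𝓡 (d + 1))) c).continuousLinearMapAt ℝ p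

/-- The inverse of the fibre coordinate of the chart of `TM` over the chart at `c`. -/
noncomputable abbrev fibreCoordSymm (c p : M) : Model d →L[ℝ] TangentSpace (𝓡 (d + 1)) p :=
  (trivializationAt (Model d) (TangentSpace (𝓡 (d + 1))) c).symmL ℝ p

theorem tangent_extChartAt_apply {u₀ u : TM d M}
    (hu : u.proj ∈ (extChartAt (𝓡 (d + 1)) u₀.proj).source) :
    extChartAt (𝓡 (d + 1)).tangent u₀ u =
      (extChartAt (𝓡 (d + 1)) u₀.proj u.proj, fibreCoord u₀.proj u.proj u.snd) := by
  have hb : u.proj ∈ (trivializationAt (Model d) (TangentSpace (𝓡 (d + 1))) u₀.proj).baseSet := by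
    simpa using hu
  rw [FiberBundle.extChartAt]
  simp only [PartialEquiv.coe_trans, Function.comp_apply, PartialEquiv.prod_coe,
    PartialEquiv.refl_coe, id]
  refine Prod.ext rfl ?_
  have := (trivializationAt (Model d) (TangentSpace (𝓡 (d + 1))) u₀.proj).continuousLinearMapAt_apply_of_mem ℝ hb
  exact (this u.snd).symm

theorem tangent_extChartAt_symm_apply {u₀ : TM d M} {x v : Model d}
    (hx : x ∈ (extChartAt (𝓡 (d + 1)) u₀.proj).target) :
    (extChartAt (𝓡 (d + 1)).tangent u₀).symm (x, v) =
      ⟨(extChartAt (𝓡 (d + 1)) u₀.proj).symm x,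
        fibreCoordSymm u₀.proj ((extChartAt (𝓡 (d + 1)) u₀.proj).symm x) v⟩ := by
  have hp := (extChartAt (𝓡 (d + 1)) u₀.proj).map_target hx
  have hb : (extChartAt (𝓡 (d + 1)) u₀.proj).symm x ∈
      (trivializationAt (Model d) (TangentSpace (𝓡 (d + 1))) u₀.proj).baseSet := by
    simpa using hp
  rw [(extChartAt (𝓡 (d + 1)).tangent u₀).symm_apply_eq (mem_tangent_extChartAt_source.2 hp)
    (mem_tangent_extChartAt_target.2 hx), tangent_extChartAt_apply hp]
  refine Prod.ext ?_ ?_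
  · exact ((extChartAt (𝓡 (d + 1)) u₀.proj).right_inv hx).symm
  · exact ((trivializationAt (Model d) (TangentSpace (𝓡 (d + 1))) u₀.proj).continuousLinearMapAt_symmL hb v).symm

theorem tangent_extChartAt_symm_proj {u₀ : TM d M} {y : Model d × Model d}
    (hy : y.1 ∈ (extChartAt (𝓡 (d + 1)) u₀.proj).target) :
    ((extChartAt (𝓡 (d + 1)).tangent u₀).symm y).proj =
      (extChartAt (𝓡 (d + 1)) u₀.proj).symm y.1 := by
  rw [tangent_extChartAt_symm_apply (x := y.1) (v := y.2) hy]

/-- The fibre coordinates are linear, so the chart turns scaling of `TM` into `scaleSnd`. -/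
theorem tangent_extChartAt_symm_scaleSnd {u₀ : TM d M} {y : Model d × Model d}
    (hy : y.1 ∈ (extChartAt (𝓡 (d + 1)) u₀.proj).target) (r : ℝ) :
    (extChartAt (𝓡 (d + 1)).tangent u₀).symm (scaleSnd _ _ r y) =
      scale r ((extChartAt (𝓡 (d + 1)).tangent u₀).symm y) := by
  obtain ⟨x, v⟩ := y
  rw [scaleSnd_apply, tangent_extChartAt_symm_apply hy, tangent_extChartAt_symm_apply hy, scale,
    map_smul]

/-- The inclusion of a fibre in a chart. -/
theorem hasMFDerivAt_fibreInclusion {u₀ : TM d M} {p : M}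
    (hp : p ∈ (extChartAt (𝓡 (d + 1)) u₀.proj).source) (z : Model d) :
    HasMFDerivAt 𝓘(ℝ, Model d) (𝓡 (d + 1)).tangent (fun w : Model d => (⟨p, w⟩ : TM d M)) z
      ((mfderiv 𝓘(ℝ, Model d × Model d) (𝓡 (d + 1)).tangent
        (extChartAt (𝓡 (d + 1)).tangent u₀).symm
        (extChartAt (𝓡 (d + 1)).tangent u₀ (⟨p, z⟩ : TM d M))).comp
          ((0 : Model d →L[ℝ] Model d).prod (fibreCoord u₀.proj p))) := by
  let A : Model d →L[ℝ] Model d := fibreCoord u₀.proj p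
  let x := extChartAt (𝓡 (d + 1)) u₀.proj p
  have hx : x ∈ (extChartAt (𝓡 (d + 1)) u₀.proj).target :=
    (extChartAt (𝓡 (d + 1)) u₀.proj).map_source hp
  -- In the chart the inclusion of the fibre is `w ↦ (x, A w)` with `A` linear, so its derivative
  -- can be read off.
  have hfun : (fun w : Model d => (⟨p, w⟩ : TM d M)) =
      (extChartAt (𝓡 (d + 1)).tangent u₀).symm ∘ fun w : Model d => (x, A w) := by
    funext w
    have h := tangent_extChartAt_apply (u₀ := u₀) (u := ⟨p, w⟩) hp
    have h2 := (extChartAt (𝓡 (d + 1)).tangent u₀).left_inv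
      (mem_tangent_extChartAt_source.2 hp : (⟨p, w⟩ : TM d M) ∈ _)
    rw [h] at h2
    exact h2.symm
  have hA : HasFDerivAt (fun w : Model d => (x, A w)) ((0 : Model d →L[ℝ] Model d).prod A) z :=
    (hasFDerivAt_const x _).prodMk A.hasFDerivAt
  have hy : extChartAt (𝓡 (d + 1)).tangent u₀ (⟨p, z⟩ : TM d M) = (x, A z) :=
    tangent_extChartAt_apply hp
  have hd : MDifferentiableAt 𝓘(ℝ, Model d × Model d) (𝓡 (d + 1)).tangent
      (extChartAt (𝓡 (d + 1)).tangent u₀).symm (x, A z) :=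
    mdifferentiableAt_extChartAt_symm (mem_tangent_extChartAt_target.2 hx)
  rw [hy, hfun]
  exact HasMFDerivAt.comp (M := Model d) z hd.hasMFDerivAt hA.hasMFDerivAt

/-- The vertical lift in a chart. -/
theorem verticalLift_eq_mfderiv_symm {u₀ u : TM d M}
    (hu : u.proj ∈ (extChartAt (𝓡 (d + 1)) u₀.proj).source)
    (w : TangentSpace (𝓡 (d + 1)) u.proj) :
    verticalLift u w = mfderiv 𝓘(ℝ, Model d × Model d) (𝓡 (d + 1)).tangent
      (extChartAt (𝓡 (d + 1)).tangent u₀).symm (extChartAt (𝓡 (d + 1)).tangent u₀ u)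
      ((0 : Model d), fibreCoord u₀.proj u.proj w) :=
  DFunLike.congr_fun (hasMFDerivAt_fibreInclusion hu (u.snd : Model d)).mfderiv w

/-- The radial field in a chart. -/
theorem mfderiv_symm_euler {u₀ : TM d M} {y : Model d × Model d}
    (hy : y.1 ∈ (extChartAt (𝓡 (d + 1)) u₀.proj).target) :
    mfderiv 𝓘(ℝ, Model d × Model d) (𝓡 (d + 1)).tangent
      (extChartAt (𝓡 (d + 1)).tangent u₀).symm y (euler _ _ y) =
    radial ((extChartAt (𝓡 (d + 1)).tangent u₀).symm y) := by
  have hy' := mem_tangent_extChartAt_target.2 hy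
  set u := (extChartAt (𝓡 (d + 1)).tangent u₀).symm y with hu
  have hs : u.proj ∈ (extChartAt (𝓡 (d + 1)) u₀.proj).source :=
    mem_tangent_extChartAt_source.1 ((extChartAt (𝓡 (d + 1)).tangent u₀).map_target hy')
  have h1 : extChartAt (𝓡 (d + 1)).tangent u₀ u = y :=
    (extChartAt (𝓡 (d + 1)).tangent u₀).right_inv hy'
  rw [radial, verticalLift_eq_mfderiv_symm hs, h1]
  have h2 := tangent_extChartAt_apply hs
  rw [h1] at h2
  have h3 : euler _ _ y = ((0 : Model d), fibreCoord u₀.proj u.proj u.snd) := by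
    rw [euler_apply]
    have h5 := congrArg Prod.snd h2
    exact Prod.ext rfl h5
  exact congrArg _ h3

/-- The vector is the Euler field at `y`, not at the scaled point: it is the velocity of the ray `c
↦ c u` at `c = r`, the vector entering `rayCoeff`. -/
theorem mfderiv_symm_euler_scale {u₀ : TM d M} {y : Model d × Model d}
    (hy : y.1 ∈ (extChartAt (𝓡 (d + 1)) u₀.proj).target) (r : ℝ) :
    mfderiv 𝓘(ℝ, Model d × Model d) (𝓡 (d + 1)).tangent
      (extChartAt (𝓡 (d + 1)).tangent u₀).symm (scaleSnd _ _ r y) (euler _ _ y) =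
    verticalLift (scale r ((extChartAt (𝓡 (d + 1)).tangent u₀).symm y))
      ((extChartAt (𝓡 (d + 1)).tangent u₀).symm y).snd := by
  have hy' := mem_tangent_extChartAt_target.2 hy
  have hy2' : scaleSnd _ _ r y ∈ (extChartAt (𝓡 (d + 1)).tangent u₀).target :=
    mem_tangent_extChartAt_target.2 hy
  have hsc := tangent_extChartAt_symm_scaleSnd (u₀ := u₀) hy r
  set u := (extChartAt (𝓡 (d + 1)).tangent u₀).symm y with hu
  have hs : u.proj ∈ (extChartAt (𝓡 (d + 1)) u₀.proj).source :=
    mem_tangent_extChartAt_source.1 ((extChartAt (𝓡 (d + 1)).tangent u₀).map_target hy')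
  have h1 : extChartAt (𝓡 (d + 1)).tangent u₀ u = y :=
    (extChartAt (𝓡 (d + 1)).tangent u₀).right_inv hy'
  have h1' : extChartAt (𝓡 (d + 1)).tangent u₀ (scale r u) = scaleSnd _ _ r y := by
    rw [← hsc]
    exact (extChartAt (𝓡 (d + 1)).tangent u₀).right_inv hy2'
  have h4 := verticalLift_eq_mfderiv_symm (u := scale r u) hs u.snd
  rw [h1'] at h4
  refine Eq.trans ?_ h4.symm
  have h2 := tangent_extChartAt_apply hs
  rw [h1] at h2
  have h3 : euler _ _ y = ((0 : Model d), fibreCoord u₀.proj u.proj u.snd) := by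
    rw [euler_apply]
    have h5 := congrArg Prod.snd h2
    exact Prod.ext rfl h5
  exact congrArg _ h3

theorem rayCoeff_eq_inChart {u₀ : TM d M} (χ : DForm (𝓡 (d + 1)).tangent (TM d M) 1)
    {y : Model d × Model d}
    (hy : y.1 ∈ (extChartAt (𝓡 (d + 1)) u₀.proj).target) (r : ℝ) :
    rayCoeff χ ((extChartAt (𝓡 (d + 1)).tangent u₀).symm y) r =
      χ.inChart u₀ (scaleSnd _ _ r y) (fun _ => euler _ _ y) := by
  have h := mfderiv_symm_euler_scale hy r
  rw [rayCoeff, ← h, DForm.inChart, ← tangent_extChartAt_symm_scaleSnd hy]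
  rfl

/-- The differential of the projection in a chart. -/
theorem mfderiv_proj_comp_mfderiv_symm {u₀ : TM d M} {y : Model d × Model d}
    (hy : y.1 ∈ (extChartAt (𝓡 (d + 1)) u₀.proj).target) :
    (mfderiv (𝓡 (d + 1)).tangent (𝓡 (d + 1)) (fun w : TM d M => w.proj)
      ((extChartAt (𝓡 (d + 1)).tangent u₀).symm y)).comp
      (mfderiv 𝓘(ℝ, Model d × Model d) (𝓡 (d + 1)).tangent
        (extChartAt (𝓡 (d + 1)).tangent u₀).symm y) =
    (mfderiv 𝓘(ℝ, Model d) (𝓡 (d + 1)) (extChartAt (𝓡 (d + 1)) u₀.proj).symm y.1).comp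
      (ContinuousLinearMap.fst ℝ (Model d) (Model d)) := by
  have hy' := mem_tangent_extChartAt_target.2 hy
  have hp : MDifferentiableAt (𝓡 (d + 1)).tangent (𝓡 (d + 1)) (fun w : TM d M => w.proj)
      ((extChartAt (𝓡 (d + 1)).tangent u₀).symm y) :=
    (Bundle.contMDiff_proj (n := 1) (TangentSpace (𝓡 (d + 1)))).mdifferentiableAt one_ne_zero
  have h1 := HasMFDerivAt.comp (M := Model d × Model d) y hp.hasMFDerivAt
    (mdifferentiableAt_extChartAt_symm hy').hasMFDerivAt
  have hfst : HasMFDerivAt 𝓘(ℝ, Model d × Model d) 𝓘(ℝ, Model d)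
      (Prod.fst : Model d × Model d → Model d) y (ContinuousLinearMap.fst ℝ (Model d) (Model d)) :=
    hasFDerivAt_fst.hasMFDerivAt
  have h2 := HasMFDerivAt.comp (M := Model d × Model d) y
    (mdifferentiableAt_extChartAt_symm hy).hasMFDerivAt hfst
  have heq : (fun w : TM d M => w.proj) ∘ (extChartAt (𝓡 (d + 1)).tangent u₀).symm =ᶠ[𝓝 y]
      (extChartAt (𝓡 (d + 1)) u₀.proj).symm ∘ Prod.fst := by
    filter_upwards [(isOpen_extChartAt_target u₀).mem_nhds hy'] with z hz
    exact tangent_extChartAt_symm_proj (mem_tangent_extChartAt_target.1 hz)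
  exact hasMFDerivAt_unique h1 (h2.congr_of_eventuallyEq heq)

theorem pullbackProj_inChart {u₀ : TM d M} {k : ℕ} (β : DForm (𝓡 (d + 1)) M k)
    {y : Model d × Model d}
    (hy : y.1 ∈ (extChartAt (𝓡 (d + 1)) u₀.proj).target) :
    (pullbackProj β).inChart u₀ y = (β.inChart u₀.proj y.1).compContinuousLinearMap
      (ContinuousLinearMap.fst ℝ (Model d) (Model d)) := by
  have h := mfderiv_proj_comp_mfderiv_symm hy
  have hp := tangent_extChartAt_symm_proj hy
  -- The two base points are equal but not definitionally so; generalising over them lets the type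
  -- of the form's value be rewritten.
  have key : ∀ (b : M → Model d [⋀^Fin k]→L[ℝ] ℝ) (p q : M)
      (L L' : (Model d × Model d) →L[ℝ] Model d), p = q → L = L' →
      (b p).compContinuousLinearMap L = (b q).compContinuousLinearMap L' := by
    rintro b p q L L' rfl rfl; rfl
  exact key β _ _ _ _ hp h

theorem wedge_inChart {E : Type*} [NormedAddCommGroup E] [NormedSpace ℝ E] {H : Type*}
    [TopologicalSpace H] {I : ModelWithCorners ℝ E H} {N : Type*} [TopologicalSpace N]
    [ChartedSpace H N] {k : ℕ} (α : DForm I N 1) (η : DForm I N k) (c : N) (y : E) :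
    (α.wedge η).inChart c y = wedgeOne (α.inChart c y) (η.inChart c y) :=
  wedgeOne_compContinuousLinearMap _ _ _

end TangentCharts

/-! ### Composition of fibre scalings -/

section Scale

variable {d : ℕ} {M : Type*} [TopologicalSpace M] [ChartedSpace (Model d) M]

theorem scale_scale (a b : ℝ) (u : TM d M) : scale a (scale b u) = scale (a * b) u := by
  have h : a • b • u.snd = (a * b) • u.snd := (mul_smul a b u.snd).symm
  exact congrArg (fun v => (⟨u.proj, v⟩ : TM d M)) h

theorem scale_one (u : TM d M) : scale 1 u = u := by
  simp [scale]

end Scale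

/-! ### Conic sub-bundles in charts; smoothness of the radial field -/

section Conic

variable {d : ℕ} {M : Type*} [TopologicalSpace M] [ChartedSpace (Model d) M]
  [IsManifold (𝓡 (d + 1)) ∞ M]

theorem mem_chartImage {u₀ : TM d M} {U : Set (TM d M)} {y : Model d × Model d} :
    y ∈ chartImage (𝓡 (d + 1)).tangent u₀ U ↔
      y.1 ∈ (extChartAt (𝓡 (d + 1)) u₀.proj).target ∧
        (extChartAt (𝓡 (d + 1)).tangent u₀).symm y ∈ U := by
  rw [chartImage, mem_inter_iff, mem_tangent_extChartAt_target, mem_preimage]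

theorem IsConicSubbundle.scale_mem_iff {U : Set (TM d M)} (hU : IsConicSubbundle U) {c : ℝ}
    (hc : c ≠ 0) {u : TM d M} : scale c u ∈ U ↔ u ∈ U := by
  refine ⟨fun h => ?_, fun h => hU.conic u h c hc⟩
  have := hU.conic _ h c⁻¹ (inv_ne_zero hc)
  rwa [scale_scale, inv_mul_cancel₀ hc, scale_one] at this

theorem IsConicSubbundle.scaleSnd_mem_chartImage_iff {U : Set (TM d M)} (hU : IsConicSubbundle U)
    {u₀ : TM d M} {y : Model d × Model d} {r : ℝ} (hr : r ≠ 0) :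
    scaleSnd _ _ r y ∈ chartImage (𝓡 (d + 1)).tangent u₀ U ↔
      y ∈ chartImage (𝓡 (d + 1)).tangent u₀ U := by
  rw [mem_chartImage, mem_chartImage]
  refine and_congr_right fun (h : y.1 ∈ _) => ?_
  rw [tangent_extChartAt_symm_scaleSnd h, hU.scale_mem_iff hr]

theorem continuousAt_tangent_symm {u₀ : TM d M} {y : Model d × Model d}
    (hy : y.1 ∈ (extChartAt (𝓡 (d + 1)) u₀.proj).target) :
    ContinuousAt (extChartAt (𝓡 (d + 1)).tangent u₀).symm y :=
  (mdifferentiableAt_extChartAt_symm (mem_tangent_extChartAt_target.2 hy)).continuousAt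

/-- Transversality of the boundary to the fibres makes the defining function regular in the chart.
Derivatives within the chart image of `U` are then determined up to the boundary, as Cartan's
formula needs. -/
theorem IsConicSubbundle.uniqueDiffOn_chartImage {U : Set (TM d M)} (hU : IsConicSubbundle U)
    (u₀ : TM d M) : UniqueDiffOn ℝ (chartImage (𝓡 (d + 1)).tangent u₀ U) := by
  intro y hy
  obtain ⟨hy1, hyU⟩ := mem_chartImage.1 hy
  have hy' := mem_tangent_extChartAt_target.2 hy1
  obtain ⟨V, hV, huV, f, hf, hUV, hf'⟩ := hU.smooth _ hyU
  have hfd : MDifferentiableAt (𝓡 (d + 1)).tangent 𝓘(ℝ, ℝ) f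
      ((extChartAt (𝓡 (d + 1)).tangent u₀).symm y) :=
    ((hf.contMDiffAt (hV.mem_nhds huV)).mdifferentiableAt (by simp))
  have hF := HasMFDerivAt.comp (M := Model d × Model d) y hfd.hasMFDerivAt
    (mdifferentiableAt_extChartAt_symm hy').hasMFDerivAt
  refine uniqueDiffWithinAt_of_nonneg hF.hasFDerivAt ?_ ?_ ?_
  · filter_upwards [(isOpen_extChartAt_target u₀).mem_nhds hy',
      (continuousAt_tangent_symm hy1).eventually (hV.mem_nhds huV)] with z hz hzV h0
    refine ⟨hz, ?_⟩
    have : (extChartAt (𝓡 (d + 1)).tangent u₀).symm z ∈ U ∩ V := by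
      rw [hUV]; exact ⟨hzV, h0⟩
    exact this.1
  · have : (extChartAt (𝓡 (d + 1)).tangent u₀).symm y ∈ U ∩ V := ⟨hyU, huV⟩
    rw [hUV] at this
    exact this.2
  · intro h0 hzero
    obtain ⟨v, hv⟩ := hf' _ huV h0
    have hs := mem_tangent_extChartAt_source.1
      ((extChartAt (𝓡 (d + 1)).tangent u₀).map_target hy')
    rw [vectorAct, verticalLift_eq_mfderiv_symm hs,
      (extChartAt (𝓡 (d + 1)).tangent u₀).right_inv hy'] at hv
    exact hv (DFunLike.congr_fun hzero ((0 : Model d), fibreCoord u₀.proj _ v))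

/-- Locally the set is an open set minus its open part `f < 0`; countably many such pieces suffice
by second countability. -/
theorem IsConicSubbundle.measurableSet_chartImage {U : Set (TM d M)} (hU : IsConicSubbundle U)
    (u₀ : TM d M) : MeasurableSet (chartImage (𝓡 (d + 1)).tangent u₀ U) := by
  let e := (extChartAt (𝓡 (d + 1)).tangent u₀).symm
  have hloc : ∀ y ∈ chartImage (𝓡 (d + 1)).tangent u₀ U, ∃ W ∈ 𝓝 y,
      MeasurableSet (W ∩ chartImage (𝓡 (d + 1)).tangent u₀ U) := by
    intro y hy
    obtain ⟨hy1, hyU⟩ := mem_chartImage.1 hy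
    have hy' := mem_tangent_extChartAt_target.2 hy1
    obtain ⟨V, hV, huV, f, hf, hUV, -⟩ := hU.smooth _ hyU
    let W := (extChartAt (𝓡 (d + 1)).tangent u₀).target ∩ e ⁻¹' V
    have hW : IsOpen W := (continuousOn_extChartAt_symm u₀).isOpen_inter_preimage
      (isOpen_extChartAt_target u₀) hV
    refine ⟨W, hW.mem_nhds ⟨hy', huV⟩, ?_⟩
    have hfe : ContinuousOn (f ∘ e) W := hf.continuousOn.comp
      ((continuousOn_extChartAt_symm u₀).mono inter_subset_left) fun z hz => hz.2
    have : W ∩ chartImage (𝓡 (d + 1)).tangent u₀ U = W \ (W ∩ (f ∘ e) ⁻¹' Iio 0) := by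
      ext z
      constructor
      · rintro ⟨hz, -, hzU⟩
        refine ⟨hz, fun h => ?_⟩
        have h1 : e z ∈ U ∩ V := ⟨hzU, hz.2⟩
        rw [hUV] at h1
        exact absurd h1.2 (not_le.2 h.2)
      · rintro ⟨hz, h⟩
        refine ⟨hz, hz.1, ?_⟩
        have h1 : e z ∈ U ∩ V := by
          rw [hUV]
          exact ⟨hz.2, not_lt.1 fun h0 => h ⟨hz, h0⟩⟩
        exact h1.1
    rw [this]
    exact hW.measurableSet.diff (hfe.isOpen_inter_preimage hW isOpen_Iio).measurableSet
  choose! W hW hWm using hloc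
  obtain ⟨t, htS, htc, ht⟩ := TopologicalSpace.countable_cover_nhdsWithin
    (f := W) (s := chartImage (𝓡 (d + 1)).tangent u₀ U)
    fun y hy => mem_nhdsWithin_of_mem_nhds (hW y hy)
  have : chartImage (𝓡 (d + 1)).tangent u₀ U =
      ⋃ y ∈ t, W y ∩ chartImage (𝓡 (d + 1)).tangent u₀ U := by
    rw [← iUnion₂_inter]
    exact (inter_eq_right.2 ht).symm
  rw [this]
  exact MeasurableSet.biUnion htc fun y hy => hWm y (htS hy)

/-- The null condition tests smooth fields only, so `R` must be shown smooth: in a chart it is the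
linear field `(0, v)`. -/
theorem smoothVectorField_radial (U : Set (TM d M)) : SmoothVectorField (fun u => radial u) U := by
  intro u₀ _
  refine ContMDiffAt.contMDiffWithinAt ?_
  rw [Bundle.contMDiffAt_section]
  have hext : ContMDiffAt (𝓡 (d + 1)).tangent 𝓘(ℝ, Model d × Model d) ∞
      (fun u : TM d M => euler (Model d) (Model d) (extChartAt (𝓡 (d + 1)).tangent u₀ u)) u₀ :=
    (euler (Model d) (Model d)).contMDiff.contMDiffAt.comp u₀ contMDiffAt_extChartAt
  refine hext.congr_of_eventuallyEq ?_
  filter_upwards [extChartAt_source_mem_nhds (I := (𝓡 (d + 1)).tangent) u₀] with u hu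
  have hy := (extChartAt (𝓡 (d + 1)).tangent u₀).map_source hu
  have h1 := mfderiv_symm_euler (mem_tangent_extChartAt_target.1 hy)
  have h2 := DFunLike.congr_fun (mfderiv_extChartAt_comp_mfderiv_symm hy)
    (euler (Model d) (Model d) (extChartAt (𝓡 (d + 1)).tangent u₀ u))
  rw [(extChartAt (𝓡 (d + 1)).tangent u₀).left_inv hu] at h1 h2
  have h3 : mfderiv (𝓡 (d + 1)).tangent 𝓘(ℝ, Model d × Model d)
    (extChartAt (𝓡 (d + 1)).tangent u₀) u (radial u) =
      euler (Model d) (Model d) (extChartAt (𝓡 (d + 1)).tangent u₀ u) := by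
    rw [← h1]; exact h2
  refine Eq.trans ?_ h3
  have hu' : u ∈ (chartAt (ModelProd (Model d) (Model d)) u₀).source := by
    rwa [extChartAt_source] at hu
  rw [← TangentBundle.continuousLinearMapAt_trivializationAt hu']
  exact (Bundle.Trivialization.continuousLinearMapAt_apply_of_mem ℝ _ (by simpa using hu') _).symm

end Conic

/-! ### Homogeneity of the integrand along rays -/

section Homogeneity

variable {d : ℕ} {M : Type*} [TopologicalSpace M] [ChartedSpace (Model d) M]
  [IsManifold (𝓡 (d + 1)) ∞ M]

theorem InteriorZero.inChart_euler {k : ℕ} {θ : DForm (𝓡 (d + 1)).tangent (TM d M) k} {u₀ : TM d M}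
    {y : Model d × Model d} (hy : y.1 ∈ (extChartAt (𝓡 (d + 1)) u₀.proj).target)
    (h : InteriorZero (radial ((extChartAt (𝓡 (d + 1)).tangent u₀).symm y))
      (θ ((extChartAt (𝓡 (d + 1)).tangent u₀).symm y))) :
    InteriorZero (euler _ _ y) (θ.inChart u₀ y) := by
  rintro v ⟨i, hi⟩
  refine h _ ⟨i, ?_⟩
  rw [← mfderiv_symm_euler hy, ← hi]
  rfl

variable {U : Set (TM d M)} {Ψ : ∀ u : TM d M, ⋀[ℝ]^2 (TangentSpace (𝓡 (d + 1)).tangent u)}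
  {θ : DForm (𝓡 (d + 1)).tangent (TM d M) (2 * d)}

/-- The factorisation `Ψ = R ∧ W` is itself admissible in the null condition. -/
theorem TransportEquations.interiorZero_radial (hΨ : IsVlasovBivector U Ψ)
    (hθ : TransportEquations U Ψ θ) {u : TM d M} (hu : u ∈ U) : InteriorZero (radial u) (θ u) := by
  obtain ⟨W, hW, hWΨ⟩ := hΨ
  exact (hθ.null _ _ (smoothVectorField_radial U) hW.smooth hWΨ u hu).1

theorem TransportEquations.inChart_interiorZero (hΨ : IsVlasovBivector U Ψ)
    (hθ : TransportEquations U Ψ θ) {u₀ : TM d M} {y : Model d × Model d}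
    (hy : y ∈ chartImage (𝓡 (d + 1)).tangent u₀ U) :
    InteriorZero (euler _ _ y) (θ.inChart u₀ y) :=
  InteriorZero.inChart_euler (mem_chartImage.1 hy).1
    (hθ.interiorZero_radial hΨ (mem_chartImage.1 hy).2)

/-- A solution of the transport equations is invariant under scaling of the fibres. -/
theorem TransportEquations.inChart_scale (hU : IsConicSubbundle U) (hΨ : IsVlasovBivector U Ψ)
    (hθs : θ.SmoothOn U) (hθ : TransportEquations U Ψ θ) {u₀ : TM d M} {y : Model d × Model d}
    (hy : y ∈ chartImage (𝓡 (d + 1)).tangent u₀ U) {r : ℝ} (hr : 0 < r) :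
    (θ.inChart u₀ (scaleSnd _ _ r y)).compContinuousLinearMap (scaleSnd _ _ r) =
      θ.inChart u₀ y :=
  compContinuousLinearMap_scaleSnd_eq (hU.uniqueDiffOn_chartImage u₀)
    ((hθs u₀).differentiableOn (by simp)) (hθ.closed u₀)
    (fun _ hz => hθ.inChart_interiorZero hΨ hz)
    (fun _ hz _ hs => (hU.scaleSnd_mem_chartImage_iff hs.ne').2 hz) hy hr

/-- The `1`-form `⟨v, dv⟩` on `ℝⁿ × ℝⁿ`, dual to the Euler field on the unit sphere bundle. -/
noncomputable def radialForm (y : Model d × Model d) : (Model d × Model d) [⋀^Fin 1]→L[ℝ] ℝ :=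
  ContinuousAlternatingMap.ofSubsingleton ℝ _ ℝ (0 : Fin 1)
    ((innerSL ℝ y.2).comp (ContinuousLinearMap.snd ℝ (Model d) (Model d)))

theorem radialForm_euler {y : Model d × Model d} (hy : ‖y.2‖ = 1) :
    radialForm y (fun _ => euler _ _ y) = 1 := by
  simp [radialForm, hy]

/-- Scaling fixes the `d + 1` base vectors of the frame and multiplies the `d + 1` fibre vectors by
`r`. -/
theorem apply_tangentFrame_scaleSnd (η : (Model d × Model d) [⋀^Fin (2 * d + 1 + 1)]→L[ℝ] ℝ)
    (r : ℝ) :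
    η (fun i => scaleSnd _ _ r (tangentFrame d i)) = r ^ (d + 1) * η (tangentFrame d) := by
  let h : 2 * d + 1 + 1 = (d + 1) + (d + 1) := by omega
  let c : Fin ((d + 1) + (d + 1)) → ℝ := Fin.append (fun _ => 1) (fun _ => r)
  have hc : ∀ i, scaleSnd _ _ r (tangentFrame d i) = c (Fin.cast h i) • tangentFrame d i := by
    intro i
    unfold tangentFrame
    generalize Fin.cast _ i = j
    refine Fin.addCases (fun j => ?_) (fun j => ?_) j
    · simp [c]
    · simp only [c, Fin.append_right]
      simp
  simp_rw [hc]
  have h1 := η.toMultilinearMap.map_smul_univ (fun i => c (Fin.cast h i)) (tangentFrame d)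
  refine h1.trans ?_
  have h2 : ∏ i, c (Fin.cast h i) = r ^ (d + 1) := by
    refine (Equiv.prod_comp (finCongr h) c).trans ?_
    rw [Fin.prod_univ_add]
    simp only [c, Fin.append_left, Fin.append_right]
    simp
  rw [h2]
  rfl

/-- The integrand is homogeneous along rays, up to the coefficient of the support form. -/
theorem wedge_inChart_scaleSnd (hU : IsConicSubbundle U) (hΨ : IsVlasovBivector U Ψ)
    (hθs : θ.SmoothOn U) (hθ : TransportEquations U Ψ θ)
    (χ : DForm (𝓡 (d + 1)).tangent (TM d M) 1) (β : DForm (𝓡 (d + 1)) M 1) {u₀ : TM d M}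
    {y : Model d × Model d} (hy : y ∈ chartImage (𝓡 (d + 1)).tangent u₀ U) (hy1 : ‖y.2‖ = 1)
    {r : ℝ} (hr : 0 < r) :
    r ^ d * ((pullbackProj β).wedge (χ.wedge θ)).inChart u₀ (scaleSnd _ _ r y) (tangentFrame d) =
      rayCoeff χ ((extChartAt (𝓡 (d + 1)).tangent u₀).symm y) r *
        wedgeOne ((pullbackProj β).inChart u₀ y) (wedgeOne (radialForm y) (θ.inChart u₀ y))
          (tangentFrame d) := by
  obtain ⟨hyt, hyU⟩ := mem_chartImage.1 hy
  set σ := scaleSnd (Model d) (Model d) r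
  have hfin : Module.finrank ℝ (Model d × Model d) = 2 * d + 1 + 1 := by
    simp; omega
  have hβ : ((pullbackProj β).inChart u₀ (σ y)).compContinuousLinearMap σ =
      (pullbackProj β).inChart u₀ y := by
    rw [pullbackProj_inChart β hyt, pullbackProj_inChart (y := σ y) β hyt]
    rfl
  have hβ0 : (pullbackProj β).inChart u₀ y (fun _ => euler _ _ y) = 0 := by
    rw [pullbackProj_inChart β hyt]
    exact (β.inChart u₀.proj y.1).map_coord_zero 0 rfl
  have hT := hθ.inChart_scale hU hΨ hθs hy hr
  -- Pushing the Euler vector forward by `σ` multiplies it by `r`, while `rayCoeff` uses the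
  -- unscaled vector. This extra `r` lowers `r^(d+1)` to `r^d = r^(n-1)`, the polar Jacobian.
  have hX : (χ.inChart u₀ (σ y)).compContinuousLinearMap σ (fun _ => euler _ _ y) =
      r * rayCoeff χ ((extChartAt (𝓡 (d + 1)).tangent u₀).symm y) r := by
    rw [rayCoeff_eq_inChart χ hyt]
    have e : σ (euler _ _ y) = r • euler _ _ y := by simp [σ]
    have := (χ.inChart u₀ (σ y)).toMultilinearMap.map_smul_univ (fun _ => r)
      (fun _ => euler _ _ y)
    simp only [Finset.univ_unique, Finset.prod_const, Finset.card_singleton, pow_one] at this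
    refine Eq.trans ?_ this
    rw [ContinuousAlternatingMap.compContinuousLinearMap_apply]
    exact congrArg _ (funext fun _ => e)
  have key := wedgeOne_wedgeOne_eq_smul hfin
    (χ := (χ.inChart u₀ (σ y)).compContinuousLinearMap σ) hβ0 (hθ.inChart_interiorZero hΨ hy)
    (radialForm_euler hy1)
  rw [hX, ← hβ, ← hT, ← wedgeOne_compContinuousLinearMap, ← wedgeOne_compContinuousLinearMap,
    hT, hβ] at key
  have key2 := congrArg (fun η => η (tangentFrame d)) key
  simp only [ContinuousAlternatingMap.smul_apply, smul_eq_mul] at key2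
  have h3 := apply_tangentFrame_scaleSnd (wedgeOne ((pullbackProj β).inChart u₀ (σ y))
    (wedgeOne (χ.inChart u₀ (σ y)) (θ.inChart u₀ (σ y)))) r
  rw [wedge_inChart, wedge_inChart]
  have h4 := h3.symm.trans key2
  rw [pow_succ] at h4
  have : r ≠ 0 := hr.ne'
  apply mul_left_cancel₀ this
  linarith

end Homogeneity

/-! ### Independence of the integral over `U` from the support form -/

section Integral

variable {d : ℕ} {M : Type*} [TopologicalSpace M] [ChartedSpace (Model d) M]
  [IsManifold (𝓡 (d + 1)) ∞ M] [T2Space M] [SigmaCompactSpace M]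
variable {U : Set (TM d M)} {Ψ : ∀ u : TM d M, ⋀[ℝ]^2 (TangentSpace (𝓡 (d + 1)).tangent u)}
  {θ : DForm (𝓡 (d + 1)).tangent (TM d M) (2 * d)}

/-- The integral over `U` does not depend on the support form. -/
theorem integralU_wedge_eq (hU : IsConicSubbundle U) (hΨ : IsVlasovBivector U Ψ)
    (hθs : θ.SmoothOn U) (hθ : TransportEquations U Ψ θ)
    {χ χ' : DForm (𝓡 (d + 1)).tangent (TM d M) 1} (hχ : IsSupportForm U χ)
    (hχ' : IsSupportForm U χ') (β : DForm (𝓡 (d + 1)) M 1)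
    (h : IntegrableU U ((pullbackProj β).wedge (χ.wedge θ)))
    (h' : IntegrableU U ((pullbackProj β).wedge (χ'.wedge θ))) :
    integralU U ((pullbackProj β).wedge (χ.wedge θ)) =
      integralU U ((pullbackProj β).wedge (χ'.wedge θ)) := by
  -- Both sides use the same charts and partition of unity, so the chart contributions can be
  -- compared one by one.
  refine finsum_congr fun c => ?_
  have hS := hU.measurableSet_chartImage (⟨c, 0⟩ : TM d M)
  have key : ∀ {χ : DForm (𝓡 (d + 1)).tangent (TM d M) 1}, IsSupportForm U χ →
      IntegrableU U ((pullbackProj β).wedge (χ.wedge θ)) → _ := fun {χ} hχ hi =>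
    setIntegral_eq_integral_sphere (volume : Measure (Model d)) (volume : Measure (Model d)) hS
      (F := bundleIntegrand ((pullbackProj β).wedge (χ.wedge θ)) c)
      (G := fun y => chartPartition d M c
        ((extChartAt (𝓡 (d + 1)).tangent (⟨c, 0⟩ : TM d M)).symm y).proj *
        wedgeOne ((pullbackProj β).inChart (⟨c, 0⟩ : TM d M) y)
          (wedgeOne (radialForm y) (θ.inChart (⟨c, 0⟩ : TM d M) y)) (tangentFrame d))
      (a := fun y => rayCoeff χ ((extChartAt (𝓡 (d + 1)).tangent (⟨c, 0⟩ : TM d M)).symm y))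
      (fun x v r hr => hU.scaleSnd_mem_chartImage_iff (y := (x, v)) hr.ne')
      (hi c)
      (fun x v hxv hv r hr => by
        have h1 := wedge_inChart_scaleSnd hU hΨ hθs hθ χ β hxv hv hr
        have hfr : Module.finrank ℝ (Model d) - 1 = d := by simp
        -- The partition function depends only on the base point, hence is constant along rays.
        have h2 : ((extChartAt (𝓡 (d + 1)).tangent (⟨c, 0⟩ : TM d M)).symm (x, r • v)).proj =
            ((extChartAt (𝓡 (d + 1)).tangent (⟨c, 0⟩ : TM d M)).symm (x, v)).proj := by
          rw [tangent_extChartAt_symm_proj (y := (x, v)) (mem_chartImage.1 hxv).1,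
            tangent_extChartAt_symm_proj (y := (x, r • v)) (mem_chartImage.1 hxv).1]
        rw [hfr, bundleIntegrand, h2]
        rw [scaleSnd_apply] at h1
        rw [mul_left_comm, h1, mul_left_comm])
      (fun x v hxv _ => hχ.integral_eq_one _ (mem_chartImage.1 hxv).2)
  -- The sphere integral on the right of `key` does not contain the support form.
  exact (key hχ h).trans (key hχ' h').symm

end Integral

/-! ### Continuity and vanishing of chart expressions -/

section Continuity

variable {E : Type*} [NormedAddCommGroup E] [NormedSpace ℝ E] {H : Type*} [TopologicalSpace H]
  {I : ModelWithCorners ℝ E H} {N : Type*} [TopologicalSpace N] [ChartedSpace H N] {k : ℕ}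

theorem DForm.SmoothOn.continuousOn_apply {η : DForm I N k} {U : Set N} (h : η.SmoothOn U) (c : N)
    (v : Fin k → E) : ContinuousOn (fun y => η.inChart c y v) (chartImage I c U) :=
  (ContinuousAlternatingMap.apply ℝ E ℝ v).continuous.comp_continuousOn (h c).continuousOn

theorem continuousOn_wedgeOne_apply {X V : Type*} [TopologicalSpace X] [AddCommGroup V]
    [Module ℝ V] [TopologicalSpace V] {α : X → V [⋀^Fin 1]→L[ℝ] ℝ} {η : X → V [⋀^Fin k]→L[ℝ] ℝ}
    {s : Set X} (hα : ∀ v, ContinuousOn (fun x => α x v) s)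
    (hη : ∀ v, ContinuousOn (fun x => η x v) s) (v : Fin (k + 1) → V) :
    ContinuousOn (fun x => wedgeOne (α x) (η x) v) s := by
  simp only [wedgeOne_apply]
  exact continuousOn_finsetSum _ fun i _ => continuousOn_const.mul ((hα _).mul (hη _))

theorem wedgeOne_zero_left {V : Type*} [AddCommGroup V] [Module ℝ V] [TopologicalSpace V]
    (η : V [⋀^Fin k]→L[ℝ] ℝ) : wedgeOne 0 η = 0 := by
  ext v; simp [wedgeOne_apply]

theorem wedgeOne_zero_right {V : Type*} [AddCommGroup V] [Module ℝ V] [TopologicalSpace V]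
    (α : V [⋀^Fin 1]→L[ℝ] ℝ) : wedgeOne α (0 : V [⋀^Fin k]→L[ℝ] ℝ) = 0 := by
  ext v; simp [wedgeOne_apply]

theorem chartImage_univ (c : N) : chartImage I c univ = (extChartAt I c).target := by
  simp [chartImage]

theorem DForm.inChart_eq_zero {η : DForm I N k} {c : N} {y : E}
    (h : η ((extChartAt I c).symm y) = 0) : η.inChart c y = 0 := by
  rw [DForm.inChart, h]
  rfl

theorem DForm.inChart_smul_of_eq {η ξ : DForm I N k} {c : N} {y : E} {t : ℝ}
    (h : η ((extChartAt I c).symm y) = t • ξ ((extChartAt I c).symm y)) :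
    η.inChart c y = t • ξ.inChart c y := by
  rw [DForm.inChart, h]
  rfl

end Continuity

/-! ### Convergence for vertically compact support -/

section VerticalCompact

variable {d : ℕ} {M : Type*} [TopologicalSpace M] [ChartedSpace (Model d) M]
  [IsManifold (𝓡 (d + 1)) ∞ M] [T2Space M] [SigmaCompactSpace M]

theorem tsupport_chartPartition_subset (c : M) :
    tsupport (chartPartition d M c) ⊆ (extChartAt (𝓡 (d + 1)) c).source := by
  rw [extChartAt_source]
  exact Classical.choose_spec (exists_chartPartition d M) c

/-- In the chart at `c` the integrand is continuous on the image of `U`, and it vanishes outside the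
image of a compact part of `U` lying over both the support of `β` and that of the partition
function, hence inside the chart domain. -/
theorem VerticalCompactSupport.integrableU {U : Set (TM d M)} (hU : IsConicSubbundle U)
    {χ : DForm (𝓡 (d + 1)).tangent (TM d M) 1} {θ : DForm (𝓡 (d + 1)).tangent (TM d M) (2 * d)}
    (hχ : χ.SmoothOn U) (hθ : θ.SmoothOn U) (h : VerticalCompactSupport U (χ.wedge θ))
    {β : DForm (𝓡 (d + 1)) M 1} (hβ : β.SmoothOn univ) {K₀ : Set M} (hK₀ : IsCompact K₀)
    (hβK : ∀ p ∉ K₀, β p = 0) : IntegrableU U ((pullbackProj β).wedge (χ.wedge θ)) := by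
  intro c
  let u₀ : TM d M := ⟨c, 0⟩
  let S := chartImage (𝓡 (d + 1)).tangent u₀ U
  let C := K₀ ∩ tsupport (chartPartition d M c)
  have hC : IsCompact C := hK₀.inter_right (isClosed_tsupport _)
  obtain ⟨K, hK, hKU, hKsupp⟩ := h C hC
  let K₁ := K ∩ (fun u : TM d M => u.proj) ⁻¹' C
  have hproj : Continuous (fun u : TM d M => u.proj) :=
    FiberBundle.continuous_proj (Model d) (TangentSpace (𝓡 (d + 1)))
  have hK₁ : IsCompact K₁ := hK.inter_right (hC.isClosed.preimage hproj)
  have hK₁s : K₁ ⊆ (extChartAt (𝓡 (d + 1)).tangent u₀).source := fun u hu =>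
    mem_tangent_extChartAt_source.2 (tsupport_chartPartition_subset c hu.2.2)
  have hK₂ : IsCompact (extChartAt (𝓡 (d + 1)).tangent u₀ '' K₁) :=
    hK₁.image_of_continuousOn ((continuousOn_extChartAt u₀).mono hK₁s)
  have hK₂S : extChartAt (𝓡 (d + 1)).tangent u₀ '' K₁ ⊆ S := by
    rintro _ ⟨u, hu, rfl⟩
    refine ⟨(extChartAt (𝓡 (d + 1)).tangent u₀).map_source (hK₁s hu), ?_⟩
    rw [mem_preimage, (extChartAt (𝓡 (d + 1)).tangent u₀).left_inv (hK₁s hu)]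
    exact hKU hu.1
  have hSt : ∀ y ∈ S, y.1 ∈ (extChartAt (𝓡 (d + 1)) c).target := fun y hy => (mem_chartImage.1 hy).1
  have hcont : ContinuousOn (bundleIntegrand ((pullbackProj β).wedge (χ.wedge θ)) c) S := by
    refine ContinuousOn.mul ?_ ?_
    · exact (chartPartition d M c).contMDiff.continuous.comp_continuousOn
        (hproj.comp_continuousOn ((continuousOn_extChartAt_symm u₀).mono inter_subset_left))
    · simp only [wedge_inChart]
      refine continuousOn_wedgeOne_apply (fun v => ?_)
        (continuousOn_wedgeOne_apply (hχ.continuousOn_apply u₀) (hθ.continuousOn_apply u₀)) _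
      have h1 : ContinuousOn (fun y : Model d × Model d => β.inChart c y.1 fun i => (v i).1) S :=
        (hβ.continuousOn_apply c _).comp continuousOn_fst fun y hy => by
          rw [chartImage_univ]; exact hSt y hy
      refine h1.congr fun y hy => ?_
      simp only
      rw [pullbackProj_inChart (u₀ := u₀) β (hSt y hy)]
      rfl
  refine ((hcont.mono hK₂S).integrableOn_compact hK₂).of_forall_sdiff_eq_zero
    (hU.measurableSet_chartImage u₀) ?_
  rintro y ⟨hy, hyK⟩
  by_contra hne
  obtain ⟨hyt, hyU⟩ := mem_chartImage.1 hy
  have hyt' := mem_tangent_extChartAt_target.2 hyt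
  obtain ⟨h1, h2⟩ := mul_ne_zero_iff.1 hne
  have hΩ : ((pullbackProj β).wedge (χ.wedge θ))
      ((extChartAt (𝓡 (d + 1)).tangent u₀).symm y) ≠ 0 := fun h0 => h2 (by
    rw [DForm.inChart_eq_zero h0]; rfl)
  have hβ0 : β ((extChartAt (𝓡 (d + 1)).tangent u₀).symm y).proj ≠ 0 := by
    intro h0
    refine hΩ ?_
    have : pullbackProj β ((extChartAt (𝓡 (d + 1)).tangent u₀).symm y) = 0 := by
      rw [pullbackProj, h0]; rfl
    rw [DForm.wedge, this, wedgeOne_zero_left]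
  have hα0 : (χ.wedge θ) ((extChartAt (𝓡 (d + 1)).tangent u₀).symm y) ≠ 0 := by
    intro h0
    refine hΩ ?_
    rw [DForm.wedge, h0, wedgeOne_zero_right]
  have hmem : ((extChartAt (𝓡 (d + 1)).tangent u₀).symm y).proj ∈ C :=
    ⟨by_contra fun h0 => hβ0 (hβK _ h0), subset_tsupport _ h1⟩
  exact hyK ⟨_, ⟨hKsupp _ hyU hmem hα0, hmem⟩,
    (extChartAt (𝓡 (d + 1)).tangent u₀).right_inv hyt'⟩

end VerticalCompact

/-! ### Forms of degree `n` and `n - 1` on the model space -/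

section TopForms

theorem frame_eq_basis (d : ℕ) :
    frame d = (EuclideanSpace.basisFun (Fin (d + 1)) ℝ).toBasis := by
  funext i
  simp [frame]

theorem eq_zero_of_apply_frame {d : ℕ} {f : Model d [⋀^Fin (d + 1)]→L[ℝ] ℝ}
    (h : f (frame d) = 0) : f = 0 := by
  apply ContinuousAlternatingMap.toAlternatingMap_injective
  have h' : f.toAlternatingMap (EuclideanSpace.basisFun (Fin (d + 1)) ℝ).toBasis = 0 := by
    rw [← frame_eq_basis]; exact h
  rw [AlternatingMap.eq_smul_basis_det (EuclideanSpace.basisFun (Fin (d + 1)) ℝ).toBasis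
    f.toAlternatingMap, h']
  simp

theorem exists_eq_smul_of_ne_zero {d : ℕ} {f : Model d [⋀^Fin (d + 1)]→L[ℝ] ℝ} (hf : f ≠ 0)
    (g : Model d [⋀^Fin (d + 1)]→L[ℝ] ℝ) : ∃ t : ℝ, g = t • f := by
  have hf' : f (frame d) ≠ 0 := fun h => hf (eq_zero_of_apply_frame h)
  refine ⟨g (frame d) / f (frame d), sub_eq_zero.1 (eq_zero_of_apply_frame ?_)⟩
  simp [hf']

/-- A nonzero form of codegree one has a nonzero wedge product with some `1`-form. -/
theorem exists_wedgeOne_ne_zero {d : ℕ} {η : Model d [⋀^Fin d]→L[ℝ] ℝ} (hη : η ≠ 0) :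
    ∃ l : Model d →L[ℝ] ℝ,
      wedgeOne (ContinuousAlternatingMap.ofSubsingleton ℝ (Model d) ℝ (0 : Fin 1) l) η ≠ 0 := by
  obtain ⟨v, hv⟩ : ∃ v, η v ≠ 0 := by
    by_contra! h
    exact hη (ContinuousAlternatingMap.ext h)
  -- The `d` vectors `v i` cannot span dimension `d + 1`. A functional `l` killing them but not `w`
  -- gives `(l ∧ η)(w, v) = l(w) η(v) ≠ 0`.
  have hlt : Submodule.span ℝ (range v) < ⊤ := by
    refine lt_top_iff_ne_top.2 fun h => ?_
    have h1 := finrank_range_le_card (R := ℝ) v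
    rw [Set.finrank, h, finrank_top] at h1
    simp at h1
  obtain ⟨l, hl0, hl⟩ := Submodule.exists_le_ker_of_lt_top _ hlt
  obtain ⟨w, hw⟩ : ∃ w, l w ≠ 0 := by
    by_contra! h
    exact hl0 (LinearMap.ext h)
  refine ⟨LinearMap.toContinuousLinearMap l, fun h => ?_⟩
  have h1 := congrArg (fun ξ : Model d [⋀^Fin (d + 1)]→L[ℝ] ℝ => ξ (Fin.cons w v)) h
  simp only [wedgeOne_apply, Fin.sum_univ_succ] at h1
  have hlv : ∀ i, l (v i) = 0 := fun i => hl (Submodule.subset_span ⟨i, rfl⟩)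
  have hrem : (0 : Fin (d + 1)).removeNth (Fin.cons w v : Fin (d + 1) → Model d) = v := by
    ext j : 1
    simp [Fin.removeNth]
  rw [hrem] at h1
  simp [hlv, hw, hv] at h1

end TopForms

/-! ### Smoothness of forms on the base -/

section Smoothness

variable {d : ℕ} {M : Type*} [TopologicalSpace M] [ChartedSpace (Model d) M]

theorem sub_smoothOn {k : ℕ} {η η' : DForm (𝓡 (d + 1)) M k} (hη : η.SmoothOn univ)
    (hη' : η'.SmoothOn univ) : DForm.SmoothOn (I := 𝓡 (d + 1)) (η - η') univ :=
  fun c => (hη c).sub (hη' c)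

theorem continuousOn_wedge_frame {β : DForm (𝓡 (d + 1)) M 1} (hβ : β.SmoothOn univ)
    {D : DForm (𝓡 (d + 1)) M d} (hD : D.SmoothOn univ) (c : M) :
    ContinuousOn (fun x => (β.wedge D).inChart c x (frame d))
      (extChartAt (𝓡 (d + 1)) c).target := by
  simp only [wedge_inChart]
  rw [← chartImage_univ]
  exact continuousOn_wedgeOne_apply (hβ.continuousOn_apply c) (hD.continuousOn_apply c) _

end Smoothness

/-! ### Differentials of functions as test forms -/

section Base

variable {d : ℕ} {M : Type*} [TopologicalSpace M] [ChartedSpace (Model d) M]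
  [IsManifold (𝓡 (d + 1)) ∞ M]

theorem inChart_frame_ne_zero {o : DForm (𝓡 (d + 1)) M (d + 1)} {c : M} {x : Model d}
    (hx : x ∈ (extChartAt (𝓡 (d + 1)) c).target)
    (ho : o ((extChartAt (𝓡 (d + 1)) c).symm x) ≠ 0) : o.inChart c x (frame d) ≠ 0 := by
  intro h
  have : IsManifold (𝓡 (d + 1)) 1 M := IsManifold.of_le (n := ∞) (by simp)
  have h0 := eq_zero_of_apply_frame h
  refine ho (ContinuousAlternatingMap.ext fun v => ?_)
  have h1 := congrArg (fun f : Model d [⋀^Fin (d + 1)]→L[ℝ] ℝ => f fun i =>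
    mfderiv (𝓡 (d + 1)) 𝓘(ℝ, Model d) (extChartAt (𝓡 (d + 1)) c)
      ((extChartAt (𝓡 (d + 1)) c).symm x) (v i)) h0
  refine Eq.trans ?_ h1
  refine congrArg _ (funext fun i => ?_)
  exact (DFunLike.congr_fun (mfderiv_symm_comp_mfderiv_extChartAt hx) (v i)).symm

/-- The differential of a function, as a `1`-form. -/
noncomputable def differential (g : M → ℝ) : DForm (𝓡 (d + 1)) M 1 := fun p =>
  ContinuousAlternatingMap.ofSubsingleton ℝ _ ℝ (0 : Fin 1)
    (mfderiv (𝓡 (d + 1)) 𝓘(ℝ, ℝ) g p : TangentSpace (𝓡 (d + 1)) p →L[ℝ] ℝ)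

theorem differential_inChart {g : M → ℝ} (hg : ContMDiff (𝓡 (d + 1)) 𝓘(ℝ, ℝ) ∞ g) {c : M}
    {x : Model d} (hx : x ∈ (extChartAt (𝓡 (d + 1)) c).target) :
    (differential g).inChart c x = ContinuousAlternatingMap.ofSubsingleton ℝ (Model d) ℝ (0 : Fin 1)
      (fderiv ℝ (g ∘ (extChartAt (𝓡 (d + 1)) c).symm) x) := by
  have : IsManifold (𝓡 (d + 1)) 1 M := IsManifold.of_le (n := ∞) (by simp)
  have h := HasMFDerivAt.comp (M := Model d) x
    ((hg.mdifferentiable (by simp)) ((extChartAt (𝓡 (d + 1)) c).symm x)).hasMFDerivAt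
    (mdifferentiableAt_extChartAt_symm hx).hasMFDerivAt
  rw [← mfderiv_eq_fderiv, h.mfderiv]
  rfl

theorem contDiffOn_comp_extChartAt_symm {g : M → ℝ} (hg : ContMDiff (𝓡 (d + 1)) 𝓘(ℝ, ℝ) ∞ g)
    (c : M) : ContDiffOn ℝ ∞ (g ∘ (extChartAt (𝓡 (d + 1)) c).symm)
      (extChartAt (𝓡 (d + 1)) c).target :=
  (hg.comp_contMDiffOn (contMDiffOn_extChartAt_symm c)).contDiffOn

theorem differential_smoothOn {g : M → ℝ} (hg : ContMDiff (𝓡 (d + 1)) 𝓘(ℝ, ℝ) ∞ g) :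
    (differential (d := d) g).SmoothOn univ := by
  intro c
  rw [chartImage_univ]
  have h := (contDiffOn_comp_extChartAt_symm hg c).fderiv_of_isOpen (m := ∞)
    (isOpen_extChartAt_target c) (by simp)
  exact ((ContinuousAlternatingMap.ofSubsingletonLIE (𝕜 := ℝ) (E := Model d) (F := ℝ)
    (0 : Fin 1)).contDiff.comp_contDiffOn h).congr fun x hx => differential_inChart hg hx

theorem smul_smoothOn {k : ℕ} {f : M → ℝ} (hf : ContMDiff (𝓡 (d + 1)) 𝓘(ℝ, ℝ) ∞ f)
    {η : DForm (𝓡 (d + 1)) M k} (hη : η.SmoothOn univ) :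
    DForm.SmoothOn (I := 𝓡 (d + 1)) (fun p => f p • η p) univ := by
  intro c
  refine ContDiffOn.smul (f := f ∘ (extChartAt (𝓡 (d + 1)) c).symm) ?_ (hη c)
  rw [chartImage_univ]
  exact contDiffOn_comp_extChartAt_symm hf c

variable [T2Space M]

/-- Every covector is the differential of a smooth function. -/
theorem exists_differential_eq (p : M) (l : Model d →L[ℝ] ℝ) :
    ∃ g : M → ℝ, ContMDiff (𝓡 (d + 1)) 𝓘(ℝ, ℝ) ∞ g ∧
      differential g p = ContinuousAlternatingMap.ofSubsingleton ℝ (Model d) ℝ (0 : Fin 1) l := by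
  have : IsManifold (𝓡 (d + 1)) 1 M := IsManifold.of_le (n := ∞) (by simp)
  obtain ⟨b⟩ : Nonempty (SmoothBumpFunction (𝓡 (d + 1)) p) := inferInstance
  have hl : ContMDiffOn (𝓡 (d + 1)) 𝓘(ℝ, ℝ) ∞ (fun q => l (extChartAt (𝓡 (d + 1)) p q))
      (chartAt (Model d) p).source :=
    l.contMDiff.comp_contMDiffOn contMDiffOn_extChartAt
  refine ⟨_, b.contMDiff_smul hl, ?_⟩
  have heq : (fun q => b q • l (extChartAt (𝓡 (d + 1)) p q)) =ᶠ[𝓝 p]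
      fun q => l (extChartAt (𝓡 (d + 1)) p q) := by
    filter_upwards [b.eventuallyEq_one] with q hq
    rw [hq]; simp
  have hder : HasMFDerivAt (𝓡 (d + 1)) 𝓘(ℝ, ℝ) (fun q => l (extChartAt (𝓡 (d + 1)) p q)) p
      (l.comp (mfderiv (𝓡 (d + 1)) 𝓘(ℝ, Model d) (extChartAt (𝓡 (d + 1)) p) p)) :=
    HasMFDerivAt.comp p l.hasFDerivAt.hasMFDerivAt
      (mdifferentiableAt_extChartAt (mem_chart_source _ p)).hasMFDerivAt
  have hmf := (hder.congr_of_eventuallyEq heq).mfderiv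
  -- The preferred chart has identity differential at its own centre, so the covector obtained is
  -- `l` itself.
  rw [mfderiv_extChartAt_self] at hmf
  refine congrArg (ContinuousAlternatingMap.ofSubsingleton ℝ (Model d) ℝ (0 : Fin 1)) ?_
  exact hmf

end Base

/-! ### Integration on `M` and the fundamental lemma -/

section FundamentalLemma

variable {d : ℕ} {M : Type*} [TopologicalSpace M] [ChartedSpace (Model d) M]
  [IsManifold (𝓡 (d + 1)) ∞ M] [T2Space M] [SigmaCompactSpace M]
  {o : DForm (𝓡 (d + 1)) M (d + 1)}

/-- The orientation sign is continuous because `o` vanishes nowhere. -/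
theorem continuousOn_baseIntegrand (ho : IsOrientationForm o) {η : DForm (𝓡 (d + 1)) M (d + 1)}
    (c : M) (hη : ContinuousOn (fun x => η.inChart c x (frame d))
      (extChartAt (𝓡 (d + 1)) c).target) :
    ContinuousOn (baseIntegrand o η c) (extChartAt (𝓡 (d + 1)) c).target := by
  refine ContinuousOn.mul ?_ (ContinuousOn.mul ?_ hη)
  · exact (chartPartition d M c).contMDiff.continuous.comp_continuousOn
      (continuousOn_extChartAt_symm c)
  · have h1 : ContinuousOn (fun x => o.inChart c x (frame d))
        (extChartAt (𝓡 (d + 1)) c).target := by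
      have := ho.smooth.continuousOn_apply c (frame d)
      rwa [chartImage_univ] at this
    intro x hx
    have h2 := (continuousAt_sign_of_ne_zero (inChart_frame_ne_zero hx (ho.ne_zero _)))
    have h3 : Continuous (fun s : SignType => (s : ℝ)) := continuous_of_discreteTopology
    exact ContinuousAt.comp_continuousWithinAt (f := fun x => o.inChart c x (frame d))
      (g := fun s : ℝ => ((SignType.sign s : SignType) : ℝ)) (h3.continuousAt.comp h2) (h1 x hx)

theorem integrableOn_baseIntegrand (ho : IsOrientationForm o) {η : DForm (𝓡 (d + 1)) M (d + 1)}
    (c : M) (hη : ContinuousOn (fun x => η.inChart c x (frame d))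
      (extChartAt (𝓡 (d + 1)) c).target) {K : Set M} (hK : IsCompact K) (hηK : ∀ p ∉ K, η p = 0) :
    IntegrableOn (baseIntegrand o η c) (extChartAt (𝓡 (d + 1)) c).target := by
  let C := K ∩ tsupport (chartPartition d M c)
  have hC : IsCompact C := hK.inter_right (isClosed_tsupport _)
  have hCs : C ⊆ (extChartAt (𝓡 (d + 1)) c).source :=
    inter_subset_right.trans (tsupport_chartPartition_subset c)
  have hC' : IsCompact (extChartAt (𝓡 (d + 1)) c '' C) :=
    hC.image_of_continuousOn ((continuousOn_extChartAt c).mono hCs)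
  have hCt : extChartAt (𝓡 (d + 1)) c '' C ⊆ (extChartAt (𝓡 (d + 1)) c).target := by
    rintro _ ⟨p, hp, rfl⟩
    exact (extChartAt (𝓡 (d + 1)) c).map_source (hCs hp)
  refine (((continuousOn_baseIntegrand ho c hη).mono hCt).integrableOn_compact
    hC').of_forall_sdiff_eq_zero (isOpen_extChartAt_target c).measurableSet ?_
  rintro x ⟨hx, hxC⟩
  by_contra hne
  obtain ⟨h1, h2⟩ := mul_ne_zero_iff.1 hne
  have h3 := (mul_ne_zero_iff.1 h2).2
  refine hxC ⟨_, ⟨by_contra fun h0 => h3 ?_, subset_tsupport _ h1⟩,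
    (extChartAt (𝓡 (d + 1)) c).right_inv hx⟩
  rw [DForm.inChart_eq_zero (hηK _ h0)]; rfl

/-- By local finiteness only finitely many partition functions meet the compact set `K`. -/
theorem finite_support_integral_baseIntegrand (o : DForm (𝓡 (d + 1)) M (d + 1))
    {η : DForm (𝓡 (d + 1)) M (d + 1)} {K : Set M} (hK : IsCompact K) (hηK : ∀ p ∉ K, η p = 0) :
    (Function.support fun c : M =>
      ∫ x in (extChartAt (𝓡 (d + 1)) c).target, baseIntegrand o η c x).Finite := by
  refine ((chartPartition d M).locallyFinite.finite_nonempty_inter_compact hK).subset ?_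
  intro c hc
  by_contra hne
  refine hc ?_
  have : ∀ x, baseIntegrand o η c x = 0 := by
    intro x
    by_contra h
    obtain ⟨h1, h2⟩ := mul_ne_zero_iff.1 h
    have h3 := (mul_ne_zero_iff.1 h2).2
    refine hne ⟨(extChartAt (𝓡 (d + 1)) c).symm x, h1, by_contra fun h0 => h3 ?_⟩
    rw [DForm.inChart_eq_zero (hηK _ h0)]; rfl
  simp [this]

/-- A compactly supported nonnegative top form which is positive somewhere has positive
integral. -/
theorem integralM_pos (ho : IsOrientationForm o) {η : DForm (𝓡 (d + 1)) M (d + 1)}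
    (hη : ∀ c, ContinuousOn (fun x => η.inChart c x (frame d)) (extChartAt (𝓡 (d + 1)) c).target)
    {K : Set M} (hK : IsCompact K) (hηK : ∀ p ∉ K, η p = 0) {t : M → ℝ}
    (hηo : ∀ p, η p = t p • o p) (ht : ∀ p, 0 ≤ t p) {p₀ : M} (hp₀ : 0 < t p₀) :
    0 < integralM o η := by
  have hval : ∀ c x, baseIntegrand o η c x = chartPartition d M c
      ((extChartAt (𝓡 (d + 1)) c).symm x) * (t ((extChartAt (𝓡 (d + 1)) c).symm x) *
        |o.inChart c x (frame d)|) := by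
    intro c x
    rw [baseIntegrand, DForm.inChart_smul_of_eq (hηo _), ← sign_mul_self]
    simp only [ContinuousAlternatingMap.smul_apply, smul_eq_mul]
    ring
  have hnonneg : ∀ c x, 0 ≤ baseIntegrand o η c x := by
    intro c x
    rw [hval]
    exact mul_nonneg ((chartPartition d M).nonneg _ _) (mul_nonneg (ht _) (abs_nonneg _))
  have hfin := finite_support_integral_baseIntegrand o hK hηK
  obtain ⟨c, hc⟩ := (chartPartition d M).exists_pos_of_mem (mem_univ p₀)
  have hcs : p₀ ∈ (extChartAt (𝓡 (d + 1)) c).source :=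
    tsupport_chartPartition_subset c (subset_tsupport _ hc.ne')
  have hct := (extChartAt (𝓡 (d + 1)) c).map_source hcs
  have hpos : 0 < baseIntegrand o η c (extChartAt (𝓡 (d + 1)) c p₀) := by
    rw [hval, (extChartAt (𝓡 (d + 1)) c).left_inv hcs]
    exact mul_pos hc (mul_pos hp₀ (abs_pos.2 (inChart_frame_ne_zero hct (ho.ne_zero _))))
  have hint : 0 < ∫ x in (extChartAt (𝓡 (d + 1)) c).target, baseIntegrand o η c x := by
    rw [setIntegral_pos_iff_support_of_nonneg_ae
      (Filter.Eventually.of_forall fun x => hnonneg c x)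
      (integrableOn_baseIntegrand ho c (hη c) hK hηK)]
    -- The set where the integrand is positive is open and contains the coordinate point of `p₀`, so
    -- it has positive measure.
    have hopen := (continuousOn_baseIntegrand ho c (hη c)).isOpen_inter_preimage
      (isOpen_extChartAt_target c) isOpen_Ioi (t := Ioi 0)
    refine (hopen.measure_pos volume ⟨_, hct, hpos⟩).trans_le (measure_mono ?_)
    rintro x ⟨hx, hx0⟩
    exact ⟨ne_of_gt hx0, hx⟩
  rw [integralM, finsum_eq_sum _ hfin]
  refine Finset.sum_pos' (fun c _ => integral_nonneg (hnonneg c)) ⟨c, ?_, hint⟩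
  rw [Set.Finite.mem_toFinset]
  exact hint.ne'

/-- The fundamental lemma of the calculus of variations for forms of codegree one. -/
theorem eq_zero_of_integralM_wedge_eq_zero (ho : IsOrientationForm o)
    {D : DForm (𝓡 (d + 1)) M d} (hD : D.SmoothOn univ)
    (h : ∀ β : DForm (𝓡 (d + 1)) M 1, β.SmoothOn univ →
      (∃ K : Set M, IsCompact K ∧ ∀ p ∉ K, β p = 0) → integralM o (β.wedge D) = 0) : D = 0 := by
  funext p₀
  by_contra hp₀
  obtain ⟨l, hl⟩ := exists_wedgeOne_ne_zero (η := D p₀) hp₀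
  obtain ⟨g, hg, hgl⟩ := exists_differential_eq p₀ l
  let κ := (differential g).wedge D
  have hκ0 : κ p₀ ≠ 0 := by
    change wedgeOne (differential g p₀) (D p₀) ≠ 0
    rw [hgl]; exact hl
  choose t ht using fun p => exists_eq_smul_of_ne_zero (f := o p) (ho.ne_zero p) (κ p)
  have ht0 : t p₀ ≠ 0 := fun h0 => hκ0 (by
    refine (ht p₀).trans ?_
    rw [h0]; exact zero_smul ℝ _)
  -- `q` is continuous and has the sign of `t`, since it equals `t` times a nonzero square on the
  -- chart target. This controls the sign of `t` near `p₀` without showing `t` continuous.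
  let q : Model d → ℝ := fun x => κ.inChart p₀ x (frame d) * o.inChart p₀ x (frame d)
  have hq : ∀ x, q x = t ((extChartAt (𝓡 (d + 1)) p₀).symm x) *
      (o.inChart p₀ x (frame d)) ^ 2 := by
    intro x
    simp only [q]
    rw [DForm.inChart_smul_of_eq (ht _)]
    simp only [ContinuousAlternatingMap.smul_apply, smul_eq_mul]
    ring
  have hqc : ContinuousOn q (extChartAt (𝓡 (d + 1)) p₀).target := by
    refine (continuousOn_wedge_frame (differential_smoothOn hg) hD p₀).mul ?_
    have := ho.smooth.continuousOn_apply p₀ (frame d)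
    rwa [chartImage_univ] at this
  let x₀ := extChartAt (𝓡 (d + 1)) p₀ p₀
  have hx₀ : x₀ ∈ (extChartAt (𝓡 (d + 1)) p₀).target := mem_extChartAt_target p₀
  have hq0 : 0 < t p₀ * q x₀ := by
    have h1 := inChart_frame_ne_zero hx₀ (ho.ne_zero _)
    rw [hq, (extChartAt (𝓡 (d + 1)) p₀).left_inv (mem_extChartAt_source p₀), ← mul_assoc]
    exact mul_pos (mul_self_pos.2 ht0) (sq_pos_iff.2 h1)
  have hev : ∀ᶠ x in 𝓝 x₀, 0 < t p₀ * q x :=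
    ((hqc.continuousAt ((isOpen_extChartAt_target p₀).mem_nhds hx₀)).const_mul _).eventually
      (lt_mem_nhds hq0)
  have hevM : ∀ᶠ p in 𝓝 p₀, 0 < t p₀ * t p := by
    filter_upwards [(continuousAt_extChartAt p₀).eventually hev,
      extChartAt_source_mem_nhds (I := 𝓡 (d + 1)) p₀] with p hp hps
    rw [hq, (extChartAt (𝓡 (d + 1)) p₀).left_inv hps, ← mul_assoc] at hp
    exact pos_of_mul_pos_left hp (sq_nonneg _)
  obtain ⟨b, -, hb⟩ := (SmoothBumpFunction.nhds_basis_support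
    (I := 𝓡 (d + 1)) (c := p₀) Filter.univ_mem).mem_iff.1 hevM
  have hf : ContMDiff (𝓡 (d + 1)) 𝓘(ℝ, ℝ) ∞ (fun p => t p₀ * b p) :=
    contMDiff_const.mul b.contMDiff
  -- The constant `t p₀` fixes the sign: `β ∧ D = b · (t p₀ t) · o`, which is nonnegative because
  -- `b` is supported where `t p₀ t > 0`.
  let β : DForm (𝓡 (d + 1)) M 1 := fun p => (t p₀ * b p) • differential g p
  have hβ : β.SmoothOn univ := smul_smoothOn hf (differential_smoothOn hg)
  have hβK : ∀ p ∉ tsupport b, β p = 0 := by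
    intro p hp
    simp only [β]
    rw [image_eq_zero_of_notMem_tsupport hp, mul_zero]
    exact zero_smul ℝ _
  have hηo : ∀ p, (β.wedge D) p = (b p * (t p₀ * t p)) • o p := by
    intro p
    have h1 : (β.wedge D) p = (t p₀ * b p) • κ p := wedgeOne_smul_left _ _ _
    rw [h1, ht p]
    refine (smul_smul _ _ _).trans ?_
    congr 1
    ring
  refine (integralM_pos ho (continuousOn_wedge_frame hβ hD) b.hasCompactSupport ?_ hηo ?_
    (p₀ := p₀) ?_).ne' (h β hβ ⟨_, b.hasCompactSupport, hβK⟩)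
  · intro p hp
    rw [DForm.wedge, hβK p hp, wedgeOne_zero_left]
  · intro p
    by_cases hp : b p = 0
    · simp [hp]
    · exact mul_nonneg b.nonneg (le_of_lt (hb hp))
  · rw [b.eq_one, one_mul]
    exact mul_self_pos.2 ht0

/-- Compact support of `β` provides the finiteness and integrability that additivity of the sum and
of the integrals requires. -/
theorem integralM_wedge_sub (ho : IsOrientationForm o) {β : DForm (𝓡 (d + 1)) M 1}
    (hβ : β.SmoothOn univ) {K : Set M} (hK : IsCompact K) (hβK : ∀ p ∉ K, β p = 0)
    {J J' : DForm (𝓡 (d + 1)) M d} (hJ : J.SmoothOn univ) (hJ' : J'.SmoothOn univ) :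
    integralM o (β.wedge (J - J')) = integralM o (β.wedge J) - integralM o (β.wedge J') := by
  have hz : ∀ (D : DForm (𝓡 (d + 1)) M d), ∀ p ∉ K, (β.wedge D) p = 0 := by
    intro D p hp
    rw [DForm.wedge, hβK p hp, wedgeOne_zero_left]
  rw [integralM, integralM, integralM,
    ← finsum_sub_distrib (finite_support_integral_baseIntegrand o hK (hz J))
      (finite_support_integral_baseIntegrand o hK (hz J'))]
  refine finsum_congr fun c => ?_
  rw [← integral_sub
    (integrableOn_baseIntegrand ho c (continuousOn_wedge_frame hβ hJ c) hK (hz J))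
    (integrableOn_baseIntegrand ho c (continuousOn_wedge_frame hβ hJ' c) hK (hz J'))]
  refine integral_congr_ae (Filter.Eventually.of_forall fun x => ?_)
  simp only [baseIntegrand, wedge_inChart]
  have : (J - J').inChart c x = J.inChart c x - J'.inChart c x := rfl
  rw [this, wedgeOne_sub_right, ContinuousAlternatingMap.sub_apply]
  ring

end FundamentalLemma

end VlasovCurrent

/-! ### Independence of the current from the support form -/

theorem mainTheorem8 {d : ℕ} {M : Type*} [TopologicalSpace M]
    [ChartedSpace (VlasovCurrent.Model d) M] [IsManifold (𝓡 (d + 1)) ∞ M]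
    [T2Space M] [SigmaCompactSpace M]
    (o : VlasovCurrent.DForm (𝓡 (d + 1)) M (d + 1)) (ho : VlasovCurrent.IsOrientationForm o)
    (U : Set (VlasovCurrent.TM d M)) (hU : VlasovCurrent.IsConicSubbundle U)
    (Ψ : ∀ u : VlasovCurrent.TM d M, ⋀[ℝ]^2 (TangentSpace (𝓡 (d + 1)).tangent u))
    (hΨ : VlasovCurrent.IsVlasovBivector U Ψ)
    (θ : VlasovCurrent.DForm (𝓡 (d + 1)).tangent (VlasovCurrent.TM d M) (2 * d))
    (hθs : θ.SmoothOn U) (hθ : VlasovCurrent.TransportEquations U Ψ θ)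
    (χ χ' : VlasovCurrent.DForm (𝓡 (d + 1)).tangent (VlasovCurrent.TM d M) 1)
    (hχ : VlasovCurrent.IsSupportForm U χ) (hχ' : VlasovCurrent.IsSupportForm U χ') :
    (∀ J J' : VlasovCurrent.DForm (𝓡 (d + 1)) M d,
      VlasovCurrent.IsFibreIntegral o U (χ.wedge θ) J →
      VlasovCurrent.IsFibreIntegral o U (χ'.wedge θ) J' → J = J') ∧
    (VlasovCurrent.VerticalCompactSupport U (χ.wedge θ) →
      VlasovCurrent.VerticalCompactSupport U (χ'.wedge θ) →
      ∀ J : VlasovCurrent.DForm (𝓡 (d + 1)) M d,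
        VlasovCurrent.IsFibreIntegral o U (χ.wedge θ) J ↔
          VlasovCurrent.IsFibreIntegral o U (χ'.wedge θ) J) := by
  open VlasovCurrent in
  refine ⟨fun J J' hJ hJ' => ?_, fun hc hc' J => ?_⟩
  · refine sub_eq_zero.1 (eq_zero_of_integralM_wedge_eq_zero ho
      (sub_smoothOn hJ.smooth hJ'.smooth) fun β hβ hβK => ?_)
    obtain ⟨K, hK, hβ0⟩ := hβK
    rw [integralM_wedge_sub ho hβ hK hβ0 hJ.smooth hJ'.smooth,
      ← hJ.integral_eq β hβ ⟨K, hK, hβ0⟩, ← hJ'.integral_eq β hβ ⟨K, hK, hβ0⟩, sub_eq_zero]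
    exact integralU_wedge_eq hU hΨ hθs hθ hχ hχ' β (hJ.integrable β hβ ⟨K, hK, hβ0⟩)
      (hJ'.integrable β hβ ⟨K, hK, hβ0⟩)
  -- Only the target form needs vertically compact support here: convergence for the other is part
  -- of the fibre integral assumed. The equivalence follows by symmetry.
  · have key : ∀ {χ χ' : DForm (𝓡 (d + 1)).tangent (TM d M) 1}, IsSupportForm U χ →
        IsSupportForm U χ' → VerticalCompactSupport U (χ'.wedge θ) →
        IsFibreIntegral o U (χ.wedge θ) J → IsFibreIntegral o U (χ'.wedge θ) J := by
      intro χ χ' hχ hχ' hc' hJ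
      have hi : ∀ β : DForm (𝓡 (d + 1)) M 1, β.SmoothOn univ →
          (∃ K : Set M, IsCompact K ∧ ∀ p ∉ K, β p = 0) →
          IntegrableU U ((pullbackProj β).wedge (χ'.wedge θ)) := fun β hβ ⟨K, hK, hβ0⟩ =>
        hc'.integrableU hU hχ'.smooth hθs hβ hK hβ0
      exact ⟨hJ.smooth, hi, fun β hβ hβK => (integralU_wedge_eq hU hΨ hθs hθ hχ' hχ β
        (hi β hβ hβK) (hJ.integrable β hβ hβK)).trans (hJ.integral_eq β hβ hβK)⟩
    exact ⟨key hχ hχ' hc', key hχ' hχ hc⟩
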